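/- Let $M$ be a closed (compact, without boundary) connected smooth manifold of dimension $n$, and let $g$ be a smooth pseudo-Riemannian metric on $M$ of indefinite signature, i.e., for no real constant $c$ is $c\cdot g$ a Riemannian metric. Assume that $g$ is light-line-complete: every light-line geodesic is defined for all times, i.e., for every $x\in M$ and every $v\in T_xM$ with $g(v,v)=0$ there is an affinely parametrized geodesic $\gamma:\mathbb{R}\to M$ with $\gamma(0)=x$ and $\dot\gamma(0)=v$. Let $(\hat M,\hat g)$ be the cone over $(M,g)$, i.e., $\hat M=\mathbb{R}_{>0}\times M$ with the pseudo-Riemannian metric $$\hat g=(dx_0)^2+x_0^2\, g,$$ where $x_0$ is the standard coordinate on $\mathbb{R}_{>0}$. Then $(\hat M,\hat g)$ is not decomposable: there are no point $p\in\hat M$ and linear subspace $U\subset T_p\hat M$ with $U\neq 0$ and $U\neq T_p\hat M$ such that the restriction of $\hat g$ to $U$ is nondegenerate and $U$ is invariant under the holonomy group of $(\hat M,\hat g)$ at $p$ (the group of parallel transports, with respect to the Levi-Civita connection of $\hat g$, along piecewise $C^1$ loops based at $p$). -/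

import Mathlib

open Set
open scoped Manifold ContDiff

namespace PseudoRiem

section Metric

variable {E : Type*} [NormedAddCommGroup E] [NormedSpace ℝ E]
  {H : Type*} [TopologicalSpace H] (I : ModelWithCorners ℝ E H)
  {M : Type*} [TopologicalSpace M] [ChartedSpace H M]

/-- The coefficients of a field `b` of bilinear forms in the chart `φ` around `x₀`: the value at
`y` of the pullback of `b` by `φ⁻¹`, on the coordinate vectors `u` and `v`. -/
noncomputable def coordForm
    (b : ∀ x : M, TangentSpace I x →ₗ[ℝ] TangentSpace I x →ₗ[ℝ] ℝ)
    (x₀ : M) (u v : E) (y : E) : ℝ :=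
  b ((extChartAt I x₀).symm y)
    (mfderiv 𝓘(ℝ, E) I (extChartAt I x₀).symm y u)
    (mfderiv 𝓘(ℝ, E) I (extChartAt I x₀).symm y v)

variable (M) in
/-- A smooth pseudo-Riemannian metric on a manifold (without boundary): a field of symmetric
nondegenerate bilinear forms on the tangent spaces whose coefficients in charts are smooth. -/
structure PseudoRiemannianMetric where
  /-- the bilinear form on the tangent space at a point -/
  form : ∀ x : M, TangentSpace I x →ₗ[ℝ] TangentSpace I x →ₗ[ℝ] ℝ
  symm : ∀ (x : M) (v w : TangentSpace I x), form x v w = form x w v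
  nondegenerate : ∀ (x : M) (v : TangentSpace I x),
    (∀ w : TangentSpace I x, form x v w = 0) → v = 0
  smooth : ∀ (x₀ : M) (u v : E),
    ContDiffOn ℝ ∞ (coordForm I form x₀ u v) (extChartAt I x₀).target

end Metric

section Connection

variable {E : Type*} [NormedAddCommGroup E] [NormedSpace ℝ E]
  {H : Type*} [TopologicalSpace H] {I : ModelWithCorners ℝ E H}
  {M : Type*} [TopologicalSpace M] [ChartedSpace H M]
  (g : PseudoRiemannianMetric I M)

/-- The metric has indefinite signature: no constant multiple of it is a Riemannian metric. -/
def IsIndefinite : Prop :=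
  ¬ ∃ c : ℝ, ∀ (x : M) (v : TangentSpace I x), v ≠ 0 → 0 < c * g.form x v v

/-- The Christoffel symbol of the first kind in the chart around `x₀`, at the coordinate point `y`:
`½ (∂ᵤ g(v, w) + ∂ᵥ g(u, w) - ∂_w g(u, v)) = g(Γ(u, v), w)`. -/
noncomputable def christoffel (x₀ : M) (y u v w : E) : ℝ :=
  (1 / 2) * (fderiv ℝ (coordForm I g.form x₀ v w) y u
    + fderiv ℝ (coordForm I g.form x₀ u w) y v
    - fderiv ℝ (coordForm I g.form x₀ u v) y w)

/-- The vector field `V` along the curve `γ` is parallel on `s` for the Levi-Civita connection: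
in every chart around `γ t`, the coordinate expressions `c` of `γ` and `v` of `V` satisfy
`v' + Γ(c', v) = 0` at `t`. The equation is paired through the metric with an arbitrary coordinate
vector `w`, which is equivalent because the metric is nondegenerate. -/
def IsParallelAlong (γ : ℝ → M) (V : ∀ t : ℝ, TangentSpace I (γ t)) (s : Set ℝ) : Prop :=
  ∀ t ∈ s, ∀ x₀ : M, γ t ∈ (extChartAt I x₀).source →
    ∃ c' v' : E,
      HasDerivWithinAt (fun τ : ℝ ↦ extChartAt I x₀ (γ τ)) c' s t ∧
      HasDerivWithinAt
        (fun τ : ℝ ↦ (mfderiv I 𝓘(ℝ, E) (extChartAt I x₀) (γ τ) (V τ) : E)) v' s t ∧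
      ∀ w : E,
        coordForm I g.form x₀ v' w (extChartAt I x₀ (γ t))
          + christoffel g x₀ (extChartAt I x₀ (γ t)) c'
              (mfderiv I 𝓘(ℝ, E) (extChartAt I x₀) (γ t) (V t)) w = 0

/-- The velocity vector of a curve. -/
noncomputable def velocity (γ : ℝ → M) (t : ℝ) : TangentSpace I (γ t) :=
  mfderiv 𝓘(ℝ, ℝ) I γ t (1 : ℝ)

/-- A geodesic defined on the whole real line (affinely parametrized). -/
def IsGeodesic (γ : ℝ → M) : Prop :=
  ContMDiff 𝓘(ℝ, ℝ) I ∞ γ ∧ IsParallelAlong g γ (velocity γ) univ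

/-- Every light-line geodesic is defined for all times: every null tangent vector is the initial
velocity of a geodesic defined on the whole real line. -/
def IsLightLineComplete : Prop :=
  ∀ (x : M) (v : TangentSpace I x), g.form x v v = 0 →
    ∃ γ : ℝ → M, IsGeodesic g γ ∧
      (⟨γ 0, velocity γ 0⟩ : TangentBundle I M) = ⟨x, v⟩

/-- `IsParallelTransport g p q A`: the isomorphism `A` from the tangent space at `p` to the one
at `q` is the parallel transport along some piecewise `C¹` path from `p` to `q`, that is, the
composition of the parallel transports along finitely many consecutive `C¹` paths. -/
inductive IsParallelTransport :
    ∀ p q : M, (TangentSpace I p ≃ₗ[ℝ] TangentSpace I q) → Prop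
  | refl (p : M) : IsParallelTransport p p (LinearEquiv.refl ℝ (TangentSpace I p))
  | step (p : M) (γ : ℝ → M)
      (A : TangentSpace I p ≃ₗ[ℝ] TangentSpace I (γ 0))
      (B : TangentSpace I (γ 0) ≃ₗ[ℝ] TangentSpace I (γ 1))
      (hA : IsParallelTransport p (γ 0) A)
      (hγ : ContMDiffOn 𝓘(ℝ, ℝ) I 1 γ (Icc 0 1))
      (hB : ∀ v : TangentSpace I (γ 0), ∃ V : ∀ t : ℝ, TangentSpace I (γ t),
        IsParallelAlong g γ V (Icc 0 1) ∧ V 0 = v ∧ V 1 = B v) :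
      IsParallelTransport p (γ 1) (A.trans B)

/-- The holonomy group at `p`: the group generated by the parallel transports along piecewise
`C¹` loops at `p`. -/
noncomputable def holonomyGroup (p : M) : Subgroup (TangentSpace I p ≃ₗ[ℝ] TangentSpace I p) :=
  Subgroup.closure {A | IsParallelTransport g p p A}

/-- Decomposability: some tangent space has a proper (nonzero and not full) nondegenerate subspace
that is invariant under the holonomy group. -/
def IsDecomposable : Prop :=
  ∃ (p : M) (U : Submodule ℝ (TangentSpace I p)),
    U ≠ ⊥ ∧ U ≠ ⊤ ∧
    (∀ u ∈ U, (∀ w ∈ U, g.form p u w = 0) → u = 0) ∧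
    ∀ A ∈ holonomyGroup g p, ∀ u ∈ U, A u ∈ U

end Connection

section Cone

/-- The open half-line `ℝ_{>0}`. -/
abbrev PosReal : TopologicalSpace.Opens ℝ := ⟨Ioi 0, isOpen_Ioi⟩

/-- The manifold `ℝ_{>0} × M`. -/
abbrev Cone (M : Type*) : Type _ := PosReal × M

variable {E : Type*} [NormedAddCommGroup E] [NormedSpace ℝ E]
  {H : Type*} [TopologicalSpace H] (I : ModelWithCorners ℝ E H)
  {M : Type*} [TopologicalSpace M] [ChartedSpace H M]

/-- The coordinate `x₀` on `ℝ_{>0} × M`. -/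
def radius (p : Cone M) : ℝ := (p.1 : ℝ)

/-- The differential `dx₀` at `p`. -/
noncomputable def dradius (p : Cone M) : TangentSpace (𝓘(ℝ, ℝ).prod I) p →ₗ[ℝ] ℝ :=
  (mfderiv (𝓘(ℝ, ℝ).prod I) 𝓘(ℝ, ℝ) (radius : Cone M → ℝ) p).toLinearMap

/-- The differential at `p` of the projection `ℝ_{>0} × M → M`. -/
noncomputable def dproj (p : Cone M) :
    TangentSpace (𝓘(ℝ, ℝ).prod I) p →ₗ[ℝ] TangentSpace I p.2 :=
  (mfderiv (𝓘(ℝ, ℝ).prod I) I (Prod.snd : Cone M → M) p).toLinearMap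

/-- The bilinear form `(dx₀)² + x₀² g` at `p`. -/
noncomputable def coneForm (b : ∀ x : M, TangentSpace I x →ₗ[ℝ] TangentSpace I x →ₗ[ℝ] ℝ)
    (p : Cone M) :
    TangentSpace (𝓘(ℝ, ℝ).prod I) p →ₗ[ℝ] TangentSpace (𝓘(ℝ, ℝ).prod I) p →ₗ[ℝ] ℝ :=
  LinearMap.mk₂ ℝ
    (fun v w ↦ dradius I p v * dradius I p w + radius p ^ 2 * b p.2 (dproj I p v) (dproj I p w))
    (by intros; simp only [map_add, LinearMap.add_apply]; ring)
    (by intros; simp only [map_smul, LinearMap.smul_apply, smul_eq_mul]; ring)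
    (by intros; simp only [map_add]; ring)
    (by intros; simp only [map_smul, smul_eq_mul]; ring)

theorem val_mdifferentiable :
    MDifferentiable 𝓘(ℝ, ℝ) 𝓘(ℝ, ℝ) (Subtype.val : PosReal → ℝ) :=
  (contMDiff_subtype_val (n := 1)).mdifferentiable (by simp)

theorem extChartAt_posReal (r : PosReal) :
    (extChartAt 𝓘(ℝ, ℝ) r : PosReal → ℝ) = Subtype.val := by
  ext x; rfl

theorem mfderiv_val (r : PosReal) (a : ℝ) :
    mfderiv 𝓘(ℝ, ℝ) 𝓘(ℝ, ℝ) (Subtype.val : PosReal → ℝ) r a = a := by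
  have h := mfderiv_extChartAt_self (I := 𝓘(ℝ, ℝ)) (x := r)
  rw [extChartAt_posReal] at h
  exact congrArg (fun L : ℝ →L[ℝ] ℝ ↦ L a) h

theorem mdifferentiable_radius :
    MDifferentiable (𝓘(ℝ, ℝ).prod I) 𝓘(ℝ, ℝ) (radius : Cone M → ℝ) :=
  fun p ↦ (val_mdifferentiable p.1).comp p mdifferentiableAt_fst

theorem dradius_apply (p : Cone M) (v : TangentSpace (𝓘(ℝ, ℝ).prod I) p) :
    dradius I p v = (v : ℝ × E).1 := by
  have h := mfderiv_comp_apply (I := 𝓘(ℝ, ℝ).prod I) (I' := 𝓘(ℝ, ℝ)) (I'' := 𝓘(ℝ, ℝ))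
    p (val_mdifferentiable p.1)
    (mdifferentiableAt_fst (I := 𝓘(ℝ, ℝ)) (I' := I) (x := p)) v
  refine h.trans ?_
  rw [mfderiv_fst]
  exact mfderiv_val p.1 _

theorem dproj_apply (p : Cone M) (v : TangentSpace (𝓘(ℝ, ℝ).prod I) p) :
    dproj I p v = (v : ℝ × E).2 := by
  simp only [dproj]
  rw [mfderiv_snd]
  rfl

theorem coneForm_apply (b : ∀ x : M, TangentSpace I x →ₗ[ℝ] TangentSpace I x →ₗ[ℝ] ℝ)
    (p : Cone M) (v w : TangentSpace (𝓘(ℝ, ℝ).prod I) p) :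
    coneForm I b p v w = (v : ℝ × E).1 * (w : ℝ × E).1
      + (p.1 : ℝ) ^ 2 * b p.2 (v : ℝ × E).2 (w : ℝ × E).2 := by
  simp only [coneForm, LinearMap.mk₂_apply, dradius_apply, dproj_apply]
  rfl

theorem extChartAt_cone_symm (p : Cone M) (y : ℝ × E)
    (hy : y ∈ (extChartAt (𝓘(ℝ, ℝ).prod I) p).target) :
    radius ((extChartAt (𝓘(ℝ, ℝ).prod I) p).symm y) = y.1 ∧
      ((extChartAt (𝓘(ℝ, ℝ).prod I) p).symm y).2 = (extChartAt I p.2).symm y.2 ∧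
      y.2 ∈ (extChartAt I p.2).target := by
  rw [extChartAt_prod] at hy ⊢
  refine ⟨?_, rfl, hy.2⟩
  have h := (extChartAt 𝓘(ℝ, ℝ) p.1).right_inv hy.1
  rw [extChartAt_posReal] at h
  exact h

theorem coordForm_coneForm [I.Boundaryless] [IsManifold I 1 M]
    (b : ∀ x : M, TangentSpace I x →ₗ[ℝ] TangentSpace I x →ₗ[ℝ] ℝ)
    (p : Cone M) (u v y : ℝ × E) (hy : y ∈ (extChartAt (𝓘(ℝ, ℝ).prod I) p).target) :
    coordForm (𝓘(ℝ, ℝ).prod I) (coneForm I b) p u v y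
      = u.1 * v.1 + y.1 ^ 2 * coordForm I b p.2 u.2 v.2 y.2 := by
  have hnhds : (extChartAt (𝓘(ℝ, ℝ).prod I) p).target ∈ nhds y :=
    extChartAt_target_mem_nhds' hy
  obtain ⟨hr, hx, hy2⟩ := extChartAt_cone_symm I p y hy
  have hsymm : MDifferentiableAt 𝓘(ℝ, ℝ × E) (𝓘(ℝ, ℝ).prod I)
      (extChartAt (𝓘(ℝ, ℝ).prod I) p).symm y := by
    have h := mdifferentiableWithinAt_extChartAt_symm (I := 𝓘(ℝ, ℝ).prod I) hy
    rwa [ModelWithCorners.range_eq_univ, mdifferentiableWithinAt_univ] at h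
  have hsymm2 : MDifferentiableAt 𝓘(ℝ, E) I (extChartAt I p.2).symm y.2 := by
    have h := mdifferentiableWithinAt_extChartAt_symm (I := I) hy2
    rwa [ModelWithCorners.range_eq_univ, mdifferentiableWithinAt_univ] at h
  have h1 : ∀ w : ℝ × E, dradius I ((extChartAt (𝓘(ℝ, ℝ).prod I) p).symm y)
      (mfderiv 𝓘(ℝ, ℝ × E) (𝓘(ℝ, ℝ).prod I) (extChartAt (𝓘(ℝ, ℝ).prod I) p).symm y w)
      = w.1 := by
    intro w
    have h := mfderiv_comp_apply y (mdifferentiable_radius I _) hsymm w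
    refine h.symm.trans ?_
    have he : (radius : Cone M → ℝ) ∘ (extChartAt (𝓘(ℝ, ℝ).prod I) p).symm
        =ᶠ[nhds y] (Prod.fst : ℝ × E → ℝ) := by
      filter_upwards [hnhds] with z hz
      exact (extChartAt_cone_symm I p z hz).1
    rw [he.mfderiv_eq, mfderiv_eq_fderiv, fderiv_fst]
    rfl
  have h2 : ∀ w : ℝ × E, (dproj I ((extChartAt (𝓘(ℝ, ℝ).prod I) p).symm y)
      (mfderiv 𝓘(ℝ, ℝ × E) (𝓘(ℝ, ℝ).prod I) (extChartAt (𝓘(ℝ, ℝ).prod I) p).symm y w) : E)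
      = mfderiv 𝓘(ℝ, E) I (extChartAt I p.2).symm y.2 w.2 := by
    intro w
    have h := mfderiv_comp_apply y
      (mdifferentiableAt_snd (I := 𝓘(ℝ, ℝ)) (I' := I)
        (x := (extChartAt (𝓘(ℝ, ℝ).prod I) p).symm y)) hsymm w
    refine h.symm.trans ?_
    have he : (Prod.snd : Cone M → M) ∘ (extChartAt (𝓘(ℝ, ℝ).prod I) p).symm
        =ᶠ[nhds y] (extChartAt I p.2).symm ∘ (Prod.snd : ℝ × E → E) := by
      filter_upwards [hnhds] with z hz
      exact (extChartAt_cone_symm I p z hz).2.1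
    have h' := mfderiv_comp_apply (I := 𝓘(ℝ, ℝ × E)) y hsymm2
      (differentiableAt_snd (𝕜 := ℝ) (E := ℝ) (F := E) (p := y)).mdifferentiableAt w
    rw [he.mfderiv_eq]
    refine h'.trans ?_
    rw [mfderiv_eq_fderiv, fderiv_snd]
    rfl
  simp only [coordForm, coneForm, LinearMap.mk₂_apply]
  rw [h1, h1, hr]
  congr 2
  have key : ∀ (q q' : M) (_ : q = q') (a c : E),
      b q a c = b q' a c := by
    rintro q _ rfl a c; rfl
  have e1 := h2 u
  have e2 := h2 v
  refine (key _ _ hx _ _).trans ?_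
  exact congrArg₂ (fun a c : E ↦ b ((extChartAt I p.2).symm y.2) a c) e1 e2

/-- The metric `(dx₀)² + x₀² g` on `ℝ_{>0} × M`. -/
noncomputable def coneMetric [I.Boundaryless] [IsManifold I 1 M]
    (g : PseudoRiemannianMetric I M) :
    PseudoRiemannianMetric (𝓘(ℝ, ℝ).prod I) (Cone M) where
  form := coneForm I g.form
  symm p v w := by
    simp only [coneForm, LinearMap.mk₂_apply]
    rw [g.symm]; ring
  nondegenerate p v hv := by
    have h1 : (v : ℝ × E).1 = 0 := by
      have h : _ = (0 : ℝ) := (coneForm_apply I g.form p v (((1 : ℝ), (0 : E)) : ℝ × E)).symm.trans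
        (hv (((1 : ℝ), (0 : E)) : ℝ × E))
      have h0 : g.form p.2 (v : ℝ × E).2 (0 : E) = 0 := map_zero (g.form p.2 (v : ℝ × E).2)
      simpa [h0] using h
    have h2 : (v : ℝ × E).2 = 0 := by
      refine g.nondegenerate p.2 _ fun w ↦ ?_
      have h : _ = (0 : ℝ) := (coneForm_apply I g.form p v (((0 : ℝ), (w : E)) : ℝ × E)).symm.trans
        (hv (((0 : ℝ), (w : E)) : ℝ × E))
      have hp : (p.1 : ℝ) ≠ 0 := ne_of_gt p.1.2
      simpa [hp] using h
    exact Prod.ext h1 h2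
  smooth p u v := by
    have h : ContDiffOn ℝ ∞
        (fun y : ℝ × E ↦ u.1 * v.1 + y.1 ^ 2 * coordForm I g.form p.2 u.2 v.2 y.2)
        (extChartAt (𝓘(ℝ, ℝ).prod I) p).target := by
      refine contDiffOn_const.add ((contDiff_fst.pow 2).contDiffOn.mul ?_)
      exact (g.smooth p.2 u.2 v.2).comp contDiff_snd.contDiffOn
        fun y hy ↦ (extChartAt_cone_symm I p y hy).2.2
    exact h.congr fun y hy ↦ coordForm_coneForm I g.form p u v y hy

end Cone

end PseudoRiem

/-!
Let `ξ = x₀ ∂₀` be the Euler field of the cone `(M̂, ĝ)`; it satisfies `∇ξ = id` and `ĝ(ξ, ξ) = 1`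
at radius one. A nondegenerate holonomy-invariant subspace `U` at a point extends to a parallel
splitting `TM̂ = U ⊕ U^⊥`. Let `P` and `Q` be the two parallel projections, and on `M`, identified
with the points of radius one, consider `α = ĝ(Pξ, Pξ)`, so that `1 - α = ĝ(Qξ, Qξ)`.

As `P` is parallel and `∇_w ξ = w`, the derivative of `α` in the direction `w ∈ TM = ξ^⊥` is
`2 ĝ(Pξ, w)`. At an extremum of `α`, which exists by compactness, `Pξ` is therefore a multiple of
`ξ`, and `P² = P` forces `Pξ = 0` or `Pξ = ξ`; accordingly `α` is `0` or `1` there. Where `Pξ = 0`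
the second-order part of `α` is `ĝ(Pw, Pw)`, and where `Pξ = ξ` the second-order part of `1 - α` is
`ĝ(Qw, Qw)`. If the minimum is `0` and the maximum is `1`, then `ĝ` is nonnegative on `U` and on
`U^⊥`, hence positive definite, and `g` is Riemannian. If both are `0`, then `ĝ` vanishes on `U`, so
`U = 0`; if both are `1`, then `ĝ` vanishes on `U^⊥`, so `U` is the whole tangent space.

In the formal proof nothing but vectors at the base point is used: `Pξ` at `x` is replaced by `P z`,
where `z` is `ξ` transported to the base point along any path, and invariance under holonomy makes
`ĝ(Pz, Pz)` independent of the path (`projection_comm_of_loop`). The analytic input is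
`exists_local_transport`: transport along short coordinate segments exists and is differentiable in
the end point at the centre, with derivative `-Γ`. For the cone this gives `exists_development`, the
first-order expansion `z(x + w) = z(x) + w + o(w)`; it suffices for both the first and the
second-order condition, since a quadratic form is evaluated at a zero of `P z` or `Q z`.
-/

namespace PseudoRiem

/-! ### Christoffel symbols and the metric in charts -/

section Calculus

variable {E : Type*} [NormedAddCommGroup E] [NormedSpace ℝ E]

/-- The Christoffel symbol of the first kind of a field `G` of bilinear forms on a vector space. -/
noncomputable def christoffelForm (G : E → E →L[ℝ] E →L[ℝ] ℝ) (y u v w : E) : ℝ :=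
  (1 / 2) * (fderiv ℝ G y u v w + fderiv ℝ G y v u w - fderiv ℝ G y w u v)

/-- Compatibility of the Levi-Civita connection with the metric. -/
theorem christoffelForm_add_swap {G : E → E →L[ℝ] E →L[ℝ] ℝ} {y : E}
    (hsymm : ∀ a u v, fderiv ℝ G y a u v = fderiv ℝ G y a v u) (u v w : E) :
    christoffelForm G y u v w + christoffelForm G y u w v = fderiv ℝ G y u v w := by
  simp only [christoffelForm]
  rw [hsymm u w v]
  ring

/-- Transformation law of the Christoffel symbols: if `G₀` is the pullback of `G₁` by `ψ`, the
symbols of `G₀` are those of `G₁` plus the second derivative of `ψ`. -/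
theorem christoffelForm_pullback {G₀ G₁ : E → E →L[ℝ] E →L[ℝ] ℝ} {ψ : E → E} {y : E}
    (hψ : ContDiffAt ℝ 2 ψ y) (hG₁ : DifferentiableAt ℝ G₁ (ψ y))
    (hG₀ : DifferentiableAt ℝ G₀ y)
    (hsymm : ∀ u v, G₁ (ψ y) u v = G₁ (ψ y) v u)
    (h : ∀ᶠ z in nhds y, ∀ u v, G₀ z u v = G₁ (ψ z) (fderiv ℝ ψ z u) (fderiv ℝ ψ z v))
    (u v w : E) :
    christoffelForm G₀ y u v w =
      christoffelForm G₁ (ψ y) (fderiv ℝ ψ y u) (fderiv ℝ ψ y v) (fderiv ℝ ψ y w)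
        + G₁ (ψ y) (fderiv ℝ (fderiv ℝ ψ) y u v) (fderiv ℝ ψ y w) := by
  have hψ1 : HasFDerivAt ψ (fderiv ℝ ψ y) y :=
    (hψ.differentiableAt (by norm_num)).hasFDerivAt
  have hψ2 : HasFDerivAt (fderiv ℝ ψ) (fderiv ℝ (fderiv ℝ ψ) y) y :=
    ((hψ.fderiv_right (m := 1) (by norm_num)).differentiableAt (by norm_num)).hasFDerivAt
  have hsym2 : ∀ a b, fderiv ℝ (fderiv ℝ ψ) y a b = fderiv ℝ (fderiv ℝ ψ) y b a := by
    have := hψ.isSymmSndFDerivAt (by simp)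
    exact fun a b ↦ this.eq a b
  have key : ∀ a b c, fderiv ℝ G₀ y a b c =
      fderiv ℝ G₁ (ψ y) (fderiv ℝ ψ y a) (fderiv ℝ ψ y b) (fderiv ℝ ψ y c)
        + G₁ (ψ y) (fderiv ℝ (fderiv ℝ ψ) y a b) (fderiv ℝ ψ y c)
        + G₁ (ψ y) (fderiv ℝ ψ y b) (fderiv ℝ (fderiv ℝ ψ) y a c) := by
    intro a b c
    have e0 : HasFDerivAt (fun z ↦ G₀ z b c) _ y :=
      (hG₀.hasFDerivAt.clm_apply (hasFDerivAt_const b y)).clm_apply (hasFDerivAt_const c y)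
    have e1 : HasFDerivAt (fun z ↦ G₁ (ψ z) (fderiv ℝ ψ z b) (fderiv ℝ ψ z c)) _ y :=
      ((hG₁.hasFDerivAt.comp y hψ1).clm_apply (hψ2.clm_apply (hasFDerivAt_const b y))).clm_apply
        (hψ2.clm_apply (hasFDerivAt_const c y))
    have e2 := e0.unique (e1.congr_of_eventuallyEq (h.mono fun z hz ↦ hz b c))
    have e3 := congrArg (fun L : E →L[ℝ] ℝ ↦ L a) e2
    simp at e3
    linarith
  simp only [christoffelForm]
  rw [key u v w, key v u w, key w u v, hsym2 v u, hsym2 w u, hsym2 w v,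
    hsymm (fderiv ℝ ψ y v), hsymm (fderiv ℝ ψ y u) (fderiv ℝ (fderiv ℝ ψ) y v w)]
  ring

theorem hasDerivWithinAt_form {G : E → E →L[ℝ] E →L[ℝ] ℝ} {c v w : ℝ → E} {c' v' w' : E}
    {s : Set ℝ} {t : ℝ} (hG : DifferentiableAt ℝ G (c t)) (hc : HasDerivWithinAt c c' s t)
    (hv : HasDerivWithinAt v v' s t) (hw : HasDerivWithinAt w w' s t) :
    HasDerivWithinAt (fun τ ↦ G (c τ) (v τ) (w τ))
      (fderiv ℝ G (c t) c' (v t) (w t) + G (c t) v' (w t) + G (c t) (v t) w') s t := by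
  have h : HasDerivWithinAt (G ∘ c) (fderiv ℝ G (c t) c') s t :=
    HasFDerivAt.comp_hasDerivWithinAt (l := G) (f := c) t hG.hasFDerivAt hc
  simpa using (h.clm_apply hv).clm_apply hw

end Calculus

section ChartDifferential

variable {E : Type*} [NormedAddCommGroup E] [NormedSpace ℝ E]
  {H : Type*} [TopologicalSpace H] (I : ModelWithCorners ℝ E H)
  {M : Type*} [TopologicalSpace M] [ChartedSpace H M]

/-- The differential at `x` of the chart around `x₀`, as an endomorphism of the model space. -/
noncomputable def chartDeriv (x₀ x : M) : E →L[ℝ] E :=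
  mfderiv I 𝓘(ℝ, E) (extChartAt I x₀) x

/-- The differential at `y` of the inverse of the chart around `x₀`. -/
noncomputable def chartSymmDeriv (x₀ : M) (y : E) : E →L[ℝ] E :=
  mfderiv 𝓘(ℝ, E) I (extChartAt I x₀).symm y

variable {I} [I.Boundaryless] [IsManifold I ∞ M]

theorem chartDeriv_chartSymmDeriv {x₀ : M} {y : E} (hy : y ∈ (extChartAt I x₀).target) (v : E) :
    chartDeriv I x₀ ((extChartAt I x₀).symm y) (chartSymmDeriv I x₀ y v) = v := by
  have : IsManifold I 1 M := IsManifold.of_le (n := ∞) (by simp)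
  have h := mfderiv_extChartAt_comp_mfderivWithin_extChartAt_symm (I := I) hy
  rw [I.range_eq_univ, mfderivWithin_univ] at h
  exact congrArg (fun L : E →L[ℝ] E ↦ L v) h

theorem chartSymmDeriv_chartDeriv {x₀ x : M} (hx : x ∈ (extChartAt I x₀).source) (v : E) :
    chartSymmDeriv I x₀ (extChartAt I x₀ x) (chartDeriv I x₀ x v) = v := by
  have : IsManifold I 1 M := IsManifold.of_le (n := ∞) (by simp)
  have h := mfderivWithin_extChartAt_symm_comp_mfderiv_extChartAt' (I := I) hx
  rw [I.range_eq_univ, mfderivWithin_univ] at h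
  exact congrArg (fun L : E →L[ℝ] E ↦ L v) h

theorem contDiffAt_coordChange (x₀ x₁ : M) {y : E} (hy : y ∈ (extChartAt I x₀).target)
    (hy' : (extChartAt I x₀).symm y ∈ (extChartAt I x₁).source) :
    ContDiffAt ℝ ∞ (extChartAt I x₁ ∘ (extChartAt I x₀).symm) y := by
  have h := contDiffWithinAt_ext_coord_change (I := I) (n := ∞) x₁ x₀ (y := y)
    (by rw [PartialEquiv.trans_source]; exact ⟨hy, hy'⟩)
  rwa [I.range_eq_univ, contDiffWithinAt_univ] at h

theorem chartDeriv_eq_fderiv_comp (x₀ x₁ : M) {x : M} (hx₀ : x ∈ (extChartAt I x₀).source)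
    (hx₁ : x ∈ (extChartAt I x₁).source) (v : E) :
    chartDeriv I x₁ x v =
      fderiv ℝ (extChartAt I x₁ ∘ (extChartAt I x₀).symm) (extChartAt I x₀ x)
        (chartDeriv I x₀ x v) := by
  have : IsManifold I 1 M := IsManifold.of_le (n := ∞) (by simp)
  have hy := (extChartAt I x₀).map_source hx₀
  have h1 : MDifferentiableAt 𝓘(ℝ, E) I (extChartAt I x₀).symm (extChartAt I x₀ x) := by
    have h := mdifferentiableWithinAt_extChartAt_symm (I := I) hy
    rwa [I.range_eq_univ, mdifferentiableWithinAt_univ] at h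
  have hxx := (extChartAt I x₀).left_inv hx₀
  have h2 : MDifferentiableAt I 𝓘(ℝ, E) (extChartAt I x₁)
      ((extChartAt I x₀).symm (extChartAt I x₀ x)) := by
    rw [hxx]
    exact mdifferentiableAt_extChartAt (by rwa [extChartAt_source] at hx₁)
  have h3 := mfderiv_comp_apply (extChartAt I x₀ x) h2 h1 (chartDeriv I x₀ x v)
  rw [mfderiv_eq_fderiv] at h3
  refine Eq.trans ?_ h3.symm
  have h4 := chartSymmDeriv_chartDeriv hx₀ v
  refine Eq.trans ?_ (congrArg (fun a : E ↦
    chartDeriv I x₁ ((extChartAt I x₀).symm (extChartAt I x₀ x)) a) h4.symm)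
  simp only [hxx]

end ChartDifferential

section CoordMetric

variable {E : Type*} [NormedAddCommGroup E] [NormedSpace ℝ E] [FiniteDimensional ℝ E]
  {H : Type*} [TopologicalSpace H] {I : ModelWithCorners ℝ E H}
  {M : Type*} [TopologicalSpace M] [ChartedSpace H M]

/-- The metric at a point as a bilinear form on the model space, with which Mathlib identifies
the tangent space. -/
noncomputable def metricAt (g : PseudoRiemannianMetric I M) (x : M) : LinearMap.BilinForm ℝ E :=
  g.form x

/-- The metric in the chart around `x₀`, as a field of continuous bilinear forms. -/
noncomputable def coordMetric (g : PseudoRiemannianMetric I M) (x₀ : M) (y : E) :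
    E →L[ℝ] E →L[ℝ] ℝ :=
  LinearMap.toContinuousLinearMap
    ((LinearMap.toContinuousLinearMap (𝕜 := ℝ) (E := E) (F' := ℝ)).toLinearMap ∘ₗ
      (LinearMap.mk₂ ℝ (fun u v : E ↦ coordForm I g.form x₀ u v y)
        (by intros; simp only [coordForm]; erw [map_add, map_add]; rfl)
        (by intros; simp only [coordForm]; erw [map_smul, map_smul]; rfl)
        (by intros; simp only [coordForm]; erw [map_add, map_add])
        (by intros; simp only [coordForm]; erw [map_smul, map_smul])))

variable (g : PseudoRiemannianMetric I M)

theorem coordMetric_apply (x₀ : M) (y u v : E) :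
    coordMetric g x₀ y u v = coordForm I g.form x₀ u v y := rfl

theorem coordMetric_symm (x₀ : M) (y u v : E) :
    coordMetric g x₀ y u v = coordMetric g x₀ y v u := by
  simp only [coordMetric_apply, coordForm]; exact g.symm _ _ _

theorem contDiffOn_coordMetric (x₀ : M) :
    ContDiffOn ℝ ∞ (coordMetric g x₀) (extChartAt I x₀).target := by
  rw [contDiffOn_clm_apply]
  intro u
  rw [contDiffOn_clm_apply]
  intro v
  exact g.smooth x₀ u v

variable [I.Boundaryless]

theorem contDiffAt_coordMetric {x₀ : M} {y : E} (hy : y ∈ (extChartAt I x₀).target) :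
    ContDiffAt ℝ ∞ (coordMetric g x₀) y :=
  (contDiffOn_coordMetric g x₀).contDiffAt (extChartAt_target_mem_nhds' hy)

theorem differentiableAt_coordMetric {x₀ : M} {y : E} (hy : y ∈ (extChartAt I x₀).target) :
    DifferentiableAt ℝ (coordMetric g x₀) y :=
  (contDiffAt_coordMetric g hy).differentiableAt (by simp)

theorem fderiv_coordForm {x₀ : M} {y : E} (hy : y ∈ (extChartAt I x₀).target) (a u v : E) :
    fderiv ℝ (coordForm I g.form x₀ u v) y a = fderiv ℝ (coordMetric g x₀) y a u v := by
  have h := ((differentiableAt_coordMetric g hy).hasFDerivAt.clm_apply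
    (hasFDerivAt_const u y)).clm_apply (hasFDerivAt_const v y)
  have h' : fderiv ℝ (coordForm I g.form x₀ u v) y = _ := h.fderiv
  rw [h']
  simp

theorem fderiv_coordMetric_symm {x₀ : M} {y : E} (hy : y ∈ (extChartAt I x₀).target)
    (a u v : E) :
    fderiv ℝ (coordMetric g x₀) y a u v = fderiv ℝ (coordMetric g x₀) y a v u := by
  rw [← fderiv_coordForm g hy, ← fderiv_coordForm g hy]
  congr 2
  ext z
  exact coordMetric_symm g x₀ z u v

theorem christoffel_eq {x₀ : M} {y : E} (hy : y ∈ (extChartAt I x₀).target) (u v w : E) :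
    christoffel g x₀ y u v w = christoffelForm (coordMetric g x₀) y u v w := by
  simp only [christoffel, christoffelForm, fderiv_coordForm g hy]

variable [IsManifold I ∞ M]

theorem coordMetric_chartDeriv {x₀ x : M} (hx : x ∈ (extChartAt I x₀).source) (v w : E) :
    coordMetric g x₀ (extChartAt I x₀ x) (chartDeriv I x₀ x v) (chartDeriv I x₀ x w)
      = metricAt g x v w := by
  have key : ∀ (q q' : M) (_ : q = q') (a c a' c' : E) (_ : a = a') (_ : c = c'),
      metricAt g q a c = metricAt g q' a' c' := by
    rintro q _ rfl a c _ _ rfl rfl; rfl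
  exact key _ _ ((extChartAt I x₀).left_inv hx) _ _ _ _ (chartSymmDeriv_chartDeriv hx v)
    (chartSymmDeriv_chartDeriv hx w)

theorem coordMetric_nondegenerate {x₀ : M} {y : E} (hy : y ∈ (extChartAt I x₀).target) {v : E}
    (h : ∀ w, coordMetric g x₀ y v w = 0) : v = 0 := by
  have h1 : chartSymmDeriv I x₀ y v = 0 := by
    refine g.nondegenerate ((extChartAt I x₀).symm y) _ fun w ↦ ?_
    have hs : (extChartAt I x₀).symm y ∈ (extChartAt I x₀).source :=
      (extChartAt I x₀).map_target hy
    have h2 := chartSymmDeriv_chartDeriv hs w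
    rw [(extChartAt I x₀).right_inv hy] at h2
    have h3 := h (chartDeriv I x₀ ((extChartAt I x₀).symm y) w)
    refine Eq.trans ?_ h3
    exact congrArg (fun a : E ↦ metricAt g ((extChartAt I x₀).symm y)
      (chartSymmDeriv I x₀ y v) a) h2.symm
  rw [← chartDeriv_chartSymmDeriv hy v, h1, map_zero]

theorem coordMetric_eq_pullback (x₀ x₁ : M) {y : E} (hy : y ∈ (extChartAt I x₀).target)
    (hy' : (extChartAt I x₀).symm y ∈ (extChartAt I x₁).source) (u v : E) :
    coordMetric g x₀ y u v =
      coordMetric g x₁ ((extChartAt I x₁ ∘ (extChartAt I x₀).symm) y)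
        (fderiv ℝ (extChartAt I x₁ ∘ (extChartAt I x₀).symm) y u)
        (fderiv ℝ (extChartAt I x₁ ∘ (extChartAt I x₀).symm) y v) := by
  have hs : (extChartAt I x₀).symm y ∈ (extChartAt I x₀).source :=
    (extChartAt I x₀).map_target hy
  have hu := chartDeriv_eq_fderiv_comp x₀ x₁ hs hy' (chartSymmDeriv I x₀ y u)
  have hv := chartDeriv_eq_fderiv_comp x₀ x₁ hs hy' (chartSymmDeriv I x₀ y v)
  rw [chartDeriv_chartSymmDeriv hy, (extChartAt I x₀).right_inv hy] at hu hv
  rw [← hu, ← hv]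
  exact (coordMetric_chartDeriv g hy' _ _).symm

end CoordMetric

/-! ### Linear differential equations along short segments -/

section LinearODE

variable {F : Type*} [NormedAddCommGroup F] [NormedSpace ℝ F] [CompleteSpace F]

/-- A linear differential equation `α' = B(t) α` on `[0, 1]` with `‖B(t)‖ ≤ c ≤ 1/2` has a solution
with given initial value `x₀` of norm at most one, and it stays `4c`-close to `x₀`. -/
theorem exists_linearODE_solution {B : ℝ → F →L[ℝ] F} {c : ℝ} (hc0 : 0 ≤ c) (hc : c ≤ 1 / 2)
    (hB : ContinuousOn B (Icc 0 1)) (hBc : ∀ t ∈ Icc (0 : ℝ) 1, ‖B t‖ ≤ c) (x₀ : F)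
    (hx₀ : ‖x₀‖ ≤ 1) :
    ∃ α : ℝ → F, α 0 = x₀ ∧ (∀ t ∈ Icc (0 : ℝ) 1, HasDerivWithinAt α (B t (α t)) (Icc 0 1) t) ∧
      ∀ t ∈ Icc (0 : ℝ) 1, ‖α t - x₀‖ ≤ 4 * c := by
  have hPL : IsPicardLindelof (fun t x ↦ B t x) (tmin := 0) (tmax := 1) ⟨0, by simp⟩ x₀ 1 0 1
      ⟨c, hc0⟩ := by
    refine ⟨fun t ht ↦ ?_, fun x _ ↦ hB.clm_apply continuousOn_const, fun t ht x hx ↦ ?_, by simp⟩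
    · refine LipschitzWith.lipschitzOnWith ((B t).lipschitz.weaken ?_)
      exact hBc t ht
    · have h1 : ‖x‖ ≤ 2 := by
        have h2 : ‖x - x₀‖ ≤ 1 := by simpa [dist_eq_norm] using hx
        have h3 := norm_add_le (x - x₀) x₀
        rw [sub_add_cancel] at h3
        linarith
      have h4 := (B t).le_opNorm x
      have h5 : ‖B t‖ * ‖x‖ ≤ (1 / 2) * 2 := by
        gcongr
        exact (hBc t ht).trans hc
      simpa using h4.trans h5
  -- the solution provided by Picard-Lindelöf carries no bound; Grönwall's inequality gives one
  obtain ⟨α, h0, hα⟩ := hPL.exists_eq_forall_mem_Icc_hasDerivWithinAt₀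
  have h0' : α 0 = x₀ := h0
  have hcont : ContinuousOn α (Icc 0 1) := fun t ht ↦ (hα t ht).continuousWithinAt
  have hright : ∀ t ∈ Ico (0 : ℝ) 1, HasDerivWithinAt α (B t (α t)) (Ici t) t := fun t ht ↦
    (hα t (Ico_subset_Icc_self ht)).mono_of_mem_nhdsWithin (Icc_mem_nhdsGE_of_mem ht)
  have hbound : ∀ t ∈ Icc (0 : ℝ) 1, ‖α t‖ ≤ 4 := by
    intro t ht
    have h := norm_le_gronwallBound_of_norm_deriv_right_le (δ := 1) (K := c) (ε := 0) hcont hright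
      (by rw [h0']; exact hx₀) (fun s hs ↦ by
        rw [add_zero]
        exact (B s).le_of_opNorm_le (hBc s (Ico_subset_Icc_self hs)) _) t ht
    refine h.trans ?_
    rw [gronwallBound_ε0, one_mul, sub_zero]
    have h1 : c * t ≤ 1 := by nlinarith [ht.1, ht.2]
    have h2 := Real.exp_le_exp.2 h1
    have h3 := Real.exp_one_lt_d9
    linarith
  refine ⟨α, h0', hα, fun t ht ↦ ?_⟩
  have h := (convex_Icc (0 : ℝ) 1).norm_image_sub_le_of_norm_hasDerivWithin_le (C := 4 * c) hα
    (fun s hs ↦ ?_) (left_mem_Icc.2 zero_le_one) ht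
  · rw [h0', sub_zero, Real.norm_of_nonneg ht.1] at h
    nlinarith [ht.1, ht.2]
  · have h1 := (B s).le_of_opNorm_le (hBc s hs) (α s)
    nlinarith [hbound s hs, norm_nonneg (α s)]

end LinearODE

section SegmentTransport

variable {E : Type*} [NormedAddCommGroup E] [NormedSpace ℝ E] [CompleteSpace E]

/-- Solution operators of the linear equations `v' = K(c) (c') v` along the segments issuing from
`y₀`. The operator at the end of the segment is differentiable in the end point at `y₀`, with
derivative `K(y₀)`. -/
theorem exists_segment_transport {K : E → E →L[ℝ] E →L[ℝ] E} {y₀ : E}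
    (hK : ∀ᶠ y in nhds y₀, ContinuousAt K y) :
    ∃ Φ : E → ℝ → E →L[ℝ] E,
      (∀ᶠ y in nhds y₀, Φ y 0 = ContinuousLinearMap.id ℝ E ∧ ∀ t ∈ Icc (0 : ℝ) 1,
        HasDerivWithinAt (Φ y) (K (y₀ + t • (y - y₀)) (y - y₀) ∘L Φ y t) (Icc 0 1) t) ∧
      Φ y₀ 1 = ContinuousLinearMap.id ℝ E ∧
      HasFDerivAt (fun y ↦ Φ y 1) (K y₀) y₀ := by
  obtain ⟨C, hC0, hC⟩ : ∃ C : ℝ, 0 < C ∧ ∀ᶠ y in nhds y₀, ‖K y‖ ≤ C := by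
    refine ⟨‖K y₀‖ + 1, by positivity, ?_⟩
    have h : Filter.Tendsto (fun y ↦ ‖K y‖) (nhds y₀) (nhds ‖K y₀‖) :=
      (continuous_norm.tendsto (K y₀)).comp hK.self_of_nhds.tendsto
    exact (h.eventually_lt_const (lt_add_one _)).mono fun y hy ↦ hy.le
  obtain ⟨δ, hδ, hball⟩ := Metric.eventually_nhds_iff_ball.1 (hK.and hC)
  -- the radius `1 / (2C)` makes the coefficient `K(c)(c')` have norm at most `1/2`
  set δ' := min δ (1 / (2 * C)) with hδ'
  have hδ'0 : 0 < δ' := lt_min hδ (by positivity)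
  have hseg : ∀ y : E, ∀ t ∈ Icc (0 : ℝ) 1, ‖y₀ + t • (y - y₀) - y₀‖ ≤ ‖y - y₀‖ := by
    intro y t ht
    rw [add_sub_cancel_left, norm_smul, Real.norm_of_nonneg ht.1]
    exact mul_le_of_le_one_left (norm_nonneg _) ht.2
  have hmem : ∀ y ∈ Metric.ball y₀ δ', ∀ t ∈ Icc (0 : ℝ) 1,
      y₀ + t • (y - y₀) ∈ Metric.ball y₀ δ := by
    intro y hy t ht
    rw [mem_ball_iff_norm] at hy ⊢
    exact ((hseg y t ht).trans_lt hy).trans_le (min_le_left _ _)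
  have hex : ∀ y ∈ Metric.ball y₀ δ', ∃ Φ : ℝ → E →L[ℝ] E, Φ 0 = ContinuousLinearMap.id ℝ E ∧
      (∀ t ∈ Icc (0 : ℝ) 1,
        HasDerivWithinAt Φ (K (y₀ + t • (y - y₀)) (y - y₀) ∘L Φ t) (Icc 0 1) t) ∧
      ∀ t ∈ Icc (0 : ℝ) 1, ‖Φ t - ContinuousLinearMap.id ℝ E‖ ≤ 4 * (C * ‖y - y₀‖) := by
    intro y hy
    have hy' : ‖y - y₀‖ < δ' := mem_ball_iff_norm.1 hy
    have hsmall : C * ‖y - y₀‖ ≤ 1 / 2 := by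
      have h1 : ‖y - y₀‖ ≤ 1 / (2 * C) := hy'.le.trans (min_le_right _ _)
      calc C * ‖y - y₀‖ ≤ C * (1 / (2 * C)) := by gcongr
        _ = 1 / 2 := by field_simp
    have := exists_linearODE_solution (F := E →L[ℝ] E)
      (B := fun t ↦ ContinuousLinearMap.compL ℝ E E E (K (y₀ + t • (y - y₀)) (y - y₀)))
      (c := C * ‖y - y₀‖) (by positivity) hsmall ?_ ?_ (ContinuousLinearMap.id ℝ E)
      ContinuousLinearMap.norm_id_le
    · simpa using this
    · refine (ContinuousLinearMap.continuous _).comp_continuousOn ?_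
      refine ContinuousOn.clm_apply (fun t ht ↦ ?_) continuousOn_const
      have h1 := (hball _ (hmem y hy t ht)).1
      exact (ContinuousAt.comp (f := fun t : ℝ ↦ y₀ + t • (y - y₀)) h1
        (by fun_prop)).continuousWithinAt
    · intro t ht
      refine (ContinuousLinearMap.opNorm_le_bound _ (norm_nonneg _) fun A ↦
        ContinuousLinearMap.opNorm_comp_le _ _).trans ?_
      exact (ContinuousLinearMap.le_of_opNorm_le _ (hball _ (hmem y hy t ht)).2 _)
  choose! Φ h0 hder hclose using hex
  have hy₀ : y₀ ∈ Metric.ball y₀ δ' := Metric.mem_ball_self hδ'0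
  have hΦy₀ : Φ y₀ 1 = ContinuousLinearMap.id ℝ E := by
    have := hclose y₀ hy₀ 1 (right_mem_Icc.2 zero_le_one)
    simpa [sub_eq_zero] using this
  refine ⟨Φ, ?_, hΦy₀, ?_⟩
  · filter_upwards [Metric.ball_mem_nhds y₀ hδ'0] with y hy
    exact ⟨h0 y hy, hder y hy⟩
  rw [hasFDerivAt_iff_isLittleO, Asymptotics.isLittleO_iff]
  intro ε hε
  -- close to `y₀` the right-hand side `K(c)(c') Φ` differs from `K(y₀)(c')` by at most `ε ‖c'‖`
  have hev1 : ∀ᶠ z in nhds y₀, ‖K z - K y₀‖ ≤ ε / 6 := by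
    refine ((Metric.tendsto_nhds (u := K) (f := nhds y₀) (a := K y₀)).1 hK.self_of_nhds (ε / 6)
      (by positivity)).mono ?_
    intro z hz
    exact (dist_eq_norm (K z) (K y₀)).symm.trans_le hz.le
  obtain ⟨ρ, hρ, hρK⟩ := Metric.eventually_nhds_iff_ball.1 hev1
  set ρ' := min (min ρ δ') (ε / (8 * C * C)) with hρ'
  have hρ'0 : 0 < ρ' := lt_min (lt_min hρ hδ'0) (by positivity)
  filter_upwards [Metric.ball_mem_nhds y₀ hρ'0] with y hy
  have hyn : ‖y - y₀‖ < ρ' := mem_ball_iff_norm.1 hy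
  have hyδ : y ∈ Metric.ball y₀ δ' :=
    mem_ball_iff_norm.2 (hyn.trans_le ((min_le_left _ _).trans (min_le_right _ _)))
  have hyC : ‖y - y₀‖ ≤ ε / (8 * C * C) := (hyn.trans_le (min_le_right _ _)).le
  have hyδ2 : ‖y - y₀‖ ≤ 1 / (2 * C) :=
    ((mem_ball_iff_norm.1 hyδ).trans_le (min_le_right _ _)).le
  have hder' : ∀ t ∈ Icc (0 : ℝ) 1, HasDerivWithinAt (fun t ↦ Φ y t - t • K y₀ (y - y₀))
      (K (y₀ + t • (y - y₀)) (y - y₀) ∘L Φ y t - (1 : ℝ) • K y₀ (y - y₀)) (Icc 0 1) t :=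
    fun t ht ↦ (hder y hyδ t ht).sub ((hasDerivWithinAt_id t (Icc (0 : ℝ) 1)).smul_const (K y₀ (y - y₀)))
  have hfinal := (convex_Icc (0 : ℝ) 1).norm_image_sub_le_of_norm_hasDerivWithin_le
    (C := ε * ‖y - y₀‖) hder' (fun t ht ↦ ?_) (left_mem_Icc.2 zero_le_one)
    (right_mem_Icc.2 zero_le_one)
  · rw [h0 y hyδ] at hfinal
    rw [hΦy₀]
    simpa [sub_right_comm] using hfinal
  · have e1 : K (y₀ + t • (y - y₀)) (y - y₀) ∘L Φ y t - (1 : ℝ) • K y₀ (y - y₀)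
        = (K (y₀ + t • (y - y₀)) - K y₀) (y - y₀)
          + K (y₀ + t • (y - y₀)) (y - y₀) ∘L (Φ y t - ContinuousLinearMap.id ℝ E) := by
      ext v
      simp
    have e2 : ‖(K (y₀ + t • (y - y₀)) - K y₀) (y - y₀)‖ ≤ ε / 6 * ‖y - y₀‖ := by
      refine ContinuousLinearMap.le_of_opNorm_le _ (hρK _ ?_) _
      rw [mem_ball_iff_norm]
      exact ((hseg y t ht).trans_lt hyn).trans_le ((min_le_left _ _).trans (min_le_left _ _))
    have e3 : ‖K (y₀ + t • (y - y₀)) (y - y₀)‖ ≤ C * ‖y - y₀‖ :=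
      ContinuousLinearMap.le_of_opNorm_le _ (hball _ (hmem y hyδ t ht)).2 _
    have e4 := hclose y hyδ t ht
    have e5 : 4 * (C * ‖y - y₀‖) * C ≤ ε / 2 := by
      calc 4 * (C * ‖y - y₀‖) * C ≤ 4 * (C * (ε / (8 * C * C))) * C := by gcongr
        _ = ε / 2 := by field_simp; norm_num
    rw [e1]
    refine (norm_add_le _ _).trans ?_
    have e6 := ContinuousLinearMap.opNorm_comp_le (K (y₀ + t • (y - y₀)) (y - y₀))
      (Φ y t - ContinuousLinearMap.id ℝ E)
    have e7 : ‖K (y₀ + t • (y - y₀)) (y - y₀)‖ * ‖Φ y t - ContinuousLinearMap.id ℝ E‖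
        ≤ C * ‖y - y₀‖ * (4 * (C * ‖y - y₀‖)) := by gcongr
    nlinarith [norm_nonneg (y - y₀)]

end SegmentTransport

/-! ### Parallel vector fields and parallel transport -/

section Parallel

variable {E : Type*} [NormedAddCommGroup E] [NormedSpace ℝ E] [FiniteDimensional ℝ E]
  {H : Type*} [TopologicalSpace H] {I : ModelWithCorners ℝ E H}
  {M : Type*} [TopologicalSpace M] [ChartedSpace H M]
  (g : PseudoRiemannianMetric I M)

/-- The equation of parallel vector fields along `γ` at time `t`, written in the chart around `x₀`
only. The field `V` is read as a curve in the model space. -/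
def IsParallelInChart (x₀ : M) (γ : ℝ → M) (V : ℝ → E) (s : Set ℝ) (t : ℝ) : Prop :=
  ∃ c' v' : E,
    HasDerivWithinAt (fun τ : ℝ ↦ extChartAt I x₀ (γ τ)) c' s t ∧
    HasDerivWithinAt (fun τ : ℝ ↦ chartDeriv I x₀ (γ τ) (V τ)) v' s t ∧
    ∀ w : E, coordMetric g x₀ (extChartAt I x₀ (γ t)) v' w
      + christoffelForm (coordMetric g x₀) (extChartAt I x₀ (γ t)) c'
          (chartDeriv I x₀ (γ t) (V t)) w = 0

variable [I.Boundaryless]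

variable {g}

theorem isParallelAlong_iff {γ : ℝ → M} {V : ∀ t : ℝ, TangentSpace I (γ t)} {s : Set ℝ} :
    IsParallelAlong g γ V s ↔ ∀ t ∈ s, ∀ x₀ : M, γ t ∈ (extChartAt I x₀).source →
      IsParallelInChart g x₀ γ V s t := by
  refine forall₂_congr fun t _ ↦ forall₂_congr fun x₀ hx ↦ exists_congr fun c' ↦
    exists_congr fun v' ↦ and_congr Iff.rfl (and_congr Iff.rfl (forall_congr' fun w ↦ ?_))
  exact iff_of_eq (congrArg (fun r ↦ coordForm I g.form x₀ v' w (extChartAt I x₀ (γ t)) + r = 0)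
    (christoffel_eq g ((extChartAt I x₀).map_source hx) c' (chartDeriv I x₀ (γ t) (V t)) w))

theorem IsParallelAlong.reverse {γ : ℝ → M} {V : ∀ t : ℝ, TangentSpace I (γ t)}
    (hV : IsParallelAlong g γ V (Icc 0 1)) :
    IsParallelAlong g (fun t ↦ γ (1 - t)) (fun t ↦ V (1 - t)) (Icc 0 1) := by
  refine isParallelAlong_iff.2 fun t ht x₀ hx ↦ ?_
  have ht' : 1 - t ∈ Icc (0 : ℝ) 1 := ⟨by linarith [ht.2], by linarith [ht.1]⟩
  obtain ⟨c', v', hc, hv, heq⟩ := isParallelAlong_iff.1 hV (1 - t) ht' x₀ hx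
  have hr : HasDerivWithinAt (fun τ : ℝ ↦ 1 - τ) (-1) (Icc 0 1) t := by
    simpa using (hasDerivWithinAt_id t (Icc (0 : ℝ) 1)).const_sub 1
  have hm : MapsTo (fun τ : ℝ ↦ 1 - τ) (Icc 0 1) (Icc 0 1) :=
    fun τ hτ ↦ ⟨by linarith [hτ.2], by linarith [hτ.1]⟩
  refine ⟨-c', -v', ?_, ?_, fun w ↦ ?_⟩
  · simpa [Function.comp_def] using hc.scomp t hr hm
  · simpa [Function.comp_def] using hv.scomp t hr hm
  · have h := heq w
    simp only [christoffelForm, map_neg, neg_apply] at h ⊢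
    linarith

variable [IsManifold I ∞ M]

/-- The equation of parallel vector fields does not depend on the chart. -/
theorem IsParallelInChart.change_chart {x₀ x₁ : M} {γ : ℝ → M} {V : ℝ → E} {s : Set ℝ} {t : ℝ}
    (h : IsParallelInChart g x₀ γ V s t) (hγ : ContinuousWithinAt γ s t) (ht : t ∈ s)
    (h₀ : γ t ∈ (extChartAt I x₀).source) (h₁ : γ t ∈ (extChartAt I x₁).source) :
    IsParallelInChart g x₁ γ V s t := by
  obtain ⟨c', v', hc, hv, heq⟩ := h
  set ψ := extChartAt I x₁ ∘ (extChartAt I x₀).symm with hψdef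
  set y := extChartAt I x₀ (γ t) with hy
  have hyt : y ∈ (extChartAt I x₀).target := (extChartAt I x₀).map_source h₀
  have hyγ : (extChartAt I x₀).symm y = γ t := (extChartAt I x₀).left_inv h₀
  have hys : (extChartAt I x₀).symm y ∈ (extChartAt I x₁).source := by rwa [hyγ]
  have hψy : ψ y = extChartAt I x₁ (γ t) := by simp only [hψdef, Function.comp, hyγ]
  have hψ : ContDiffAt ℝ ∞ ψ y := contDiffAt_coordChange x₀ x₁ hyt hys
  have hψ₂ : ContDiffAt ℝ 2 ψ y := hψ.of_le ENat.LEInfty.out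
  have hd1 : HasFDerivAt ψ (fderiv ℝ ψ y) y :=
    (hψ₂.differentiableAt (by norm_num)).hasFDerivAt
  have hd2 : HasFDerivAt (fderiv ℝ ψ) (fderiv ℝ (fderiv ℝ ψ) y) y :=
    ((hψ₂.fderiv_right (m := 1) (by norm_num)).differentiableAt (by norm_num)).hasFDerivAt
  have hev₀ : ∀ᶠ τ in nhdsWithin t s, γ τ ∈ (extChartAt I x₀).source :=
    hγ.eventually ((isOpen_extChartAt_source x₀).mem_nhds h₀)
  have hev₁ : ∀ᶠ τ in nhdsWithin t s, γ τ ∈ (extChartAt I x₁).source :=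
    hγ.eventually ((isOpen_extChartAt_source x₁).mem_nhds h₁)
  have hvt := chartDeriv_eq_fderiv_comp x₀ x₁ h₀ h₁ (V t)
  refine ⟨fderiv ℝ ψ y c', fderiv ℝ (fderiv ℝ ψ) y c' (chartDeriv I x₀ (γ t) (V t))
    + fderiv ℝ ψ y v', ?_, ?_, fun w ↦ ?_⟩
  · have h1 : HasDerivWithinAt (fun τ ↦ ψ (extChartAt I x₀ (γ τ))) (fderiv ℝ ψ y c') s t :=
      HasFDerivAt.comp_hasDerivWithinAt t hd1 hc
    refine h1.congr_of_eventuallyEq_of_mem ?_ ht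
    filter_upwards [hev₀] with τ hτ
    simp only [hψdef, Function.comp, (extChartAt I x₀).left_inv hτ]
  · have h2 : HasDerivWithinAt (fun τ ↦ fderiv ℝ ψ (extChartAt I x₀ (γ τ)))
        (fderiv ℝ (fderiv ℝ ψ) y c') s t := HasFDerivAt.comp_hasDerivWithinAt t hd2 hc
    refine (h2.clm_apply hv).congr_of_eventuallyEq_of_mem ?_ ht
    filter_upwards [hev₀, hev₁] with τ hτ hτ'
    exact chartDeriv_eq_fderiv_comp x₀ x₁ hτ hτ' (V τ)
  · -- the differential of the coordinate change is onto, so `w` may be taken in its range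
    obtain ⟨w₀, rfl⟩ : ∃ w₀, fderiv ℝ ψ y w₀ = w := by
      refine ⟨chartDeriv I x₀ (γ t) (chartSymmDeriv I x₁ (extChartAt I x₁ (γ t)) w), ?_⟩
      rw [← chartDeriv_eq_fderiv_comp x₀ x₁ h₀ h₁]
      have h5 := chartDeriv_chartSymmDeriv ((extChartAt I x₁).map_source h₁) w
      rwa [(extChartAt I x₁).left_inv h₁] at h5
    have hnear : ∀ᶠ z in nhds y, ∀ u v, coordMetric g x₀ z u v =
        coordMetric g x₁ (ψ z) (fderiv ℝ ψ z u) (fderiv ℝ ψ z v) := by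
      have hc1 : ContinuousAt (extChartAt I x₀).symm y := continuousAt_extChartAt_symm'' hyt
      filter_upwards [extChartAt_target_mem_nhds' hyt,
        hc1.eventually ((isOpen_extChartAt_source x₁).mem_nhds hys)] with z hz hz' u v
      exact coordMetric_eq_pullback g x₀ x₁ hz hz' u v
    have hψt : ψ y ∈ (extChartAt I x₁).target := by
      rw [hψy]; exact (extChartAt I x₁).map_source h₁
    have hlaw := christoffelForm_pullback hψ₂ (differentiableAt_coordMetric g hψt)
      (differentiableAt_coordMetric g hyt) (coordMetric_symm g x₁ _) hnear c'
      (chartDeriv I x₀ (γ t) (V t)) w₀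
    have h6 := heq w₀
    rw [hlaw, coordMetric_eq_pullback g x₀ x₁ hyt hys] at h6
    rw [hvt, ← hψy, map_add, add_apply]
    linarith

theorem isParallelAlong_of_chart {γ : ℝ → M} {V : ∀ t : ℝ, TangentSpace I (γ t)} {s : Set ℝ}
    (hγ : ContinuousOn γ s) (x₀ : M) (hs : ∀ t ∈ s, γ t ∈ (extChartAt I x₀).source)
    (h : ∀ t ∈ s, IsParallelInChart g x₀ γ V s t) : IsParallelAlong g γ V s :=
  isParallelAlong_iff.2 fun t ht _ hx ↦ (h t ht).change_chart (hγ t ht) ht (hs t ht) hx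

/-- The metric is constant on pairs of parallel vector fields. -/
theorem metricAt_eq_of_isParallelAlong {γ : ℝ → M} {V W : ∀ t : ℝ, TangentSpace I (γ t)}
    (hγ : ContinuousOn γ (Icc 0 1))
    (hV : IsParallelAlong g γ V (Icc 0 1)) (hW : IsParallelAlong g γ W (Icc 0 1)) :
    metricAt g (γ 1) (V 1) (W 1) = metricAt g (γ 0) (V 0) (W 0) := by
  have hder : ∀ t ∈ Icc (0 : ℝ) 1,
      HasDerivWithinAt (fun τ ↦ metricAt g (γ τ) (V τ) (W τ)) 0 (Icc 0 1) t := by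
    intro t ht
    have hx := mem_extChartAt_source (I := I) (γ t)
    have hy := (extChartAt I (γ t)).map_source hx
    obtain ⟨c', v', hc, hv, hveq⟩ := isParallelAlong_iff.1 hV t ht (γ t) hx
    obtain ⟨d', w', hd, hw, hweq⟩ := isParallelAlong_iff.1 hW t ht (γ t) hx
    obtain rfl : c' = d' := (uniqueDiffOn_Icc zero_lt_one t ht).eq_deriv _ hc hd
    have h1 := hasDerivWithinAt_form (differentiableAt_coordMetric g hy) hc hv hw
    have h2 := h1.congr_of_eventuallyEq_of_mem
      (f₁ := fun τ ↦ metricAt g (γ τ) (V τ) (W τ)) ?_ ht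
    · refine h2.congr_deriv ?_
      have e1 := hveq (chartDeriv I (γ t) (γ t) (W t))
      have e2 := hweq (chartDeriv I (γ t) (γ t) (V t))
      have e3 := christoffelForm_add_swap (fderiv_coordMetric_symm g hy) c'
        (chartDeriv I (γ t) (γ t) (V t)) (chartDeriv I (γ t) (γ t) (W t))
      have e4 := coordMetric_symm g (γ t) (extChartAt I (γ t) (γ t)) w'
        (chartDeriv I (γ t) (γ t) (V t))
      linarith
    · filter_upwards [(hγ t ht).eventually ((isOpen_extChartAt_source (γ t)).mem_nhds hx)]
        with τ hτ
      exact (coordMetric_chartDeriv g hτ (V τ) (W τ)).symm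
  have h := (convex_Icc (0 : ℝ) 1).norm_image_sub_le_of_norm_hasDerivWithin_le (C := 0) hder
    (fun t _ ↦ by simp) (left_mem_Icc.2 zero_le_one) (right_mem_Icc.2 zero_le_one)
  rw [zero_mul, norm_le_zero_iff, sub_eq_zero] at h
  exact h

end Parallel

section ParallelTransport

variable {E : Type*} [NormedAddCommGroup E] [NormedSpace ℝ E]
  {H : Type*} [TopologicalSpace H] {I : ModelWithCorners ℝ E H}
  {M : Type*} [TopologicalSpace M] [ChartedSpace H M]
  {g : PseudoRiemannianMetric I M}

/-- Parallel transport along one `C¹` path whose end points are given up to equality. -/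
theorem IsParallelTransport.single {p q : M} {B : TangentSpace I p ≃ₗ[ℝ] TangentSpace I q}
    (γ : ℝ → M) (h0 : γ 0 = p) (h1 : γ 1 = q)
    (hγ : ContMDiffOn 𝓘(ℝ, ℝ) I 1 γ (Icc 0 1))
    (hB : ∀ v : E, ∃ V : ℝ → E, IsParallelAlong g γ V (Icc 0 1) ∧ V 0 = v ∧ V 1 = B v) :
    IsParallelTransport g p q B := by
  subst h0 h1
  exact IsParallelTransport.step (γ 0) γ (LinearEquiv.refl ℝ _) B (.refl _) hγ hB

theorem IsParallelTransport.trans {p q r : M} {A : TangentSpace I p ≃ₗ[ℝ] TangentSpace I q}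
    {B : TangentSpace I q ≃ₗ[ℝ] TangentSpace I r} (hA : IsParallelTransport g p q A)
    (hB : IsParallelTransport g q r B) : IsParallelTransport g p r (A.trans B) := by
  induction hB with
  | refl => exact hA
  | step γ A' B hA' hγ hB ih => exact IsParallelTransport.step p γ (A.trans A') B ih hγ hB

variable [FiniteDimensional ℝ E] [I.Boundaryless]

theorem IsParallelTransport.symm {p q : M} {A : TangentSpace I p ≃ₗ[ℝ] TangentSpace I q}
    (hA : IsParallelTransport g p q A) : IsParallelTransport g q p A.symm := by
  induction hA with
  | refl => exact .refl p
  | step γ A B hA hγ hB ih =>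
    have h : IsParallelTransport g (γ 1) (γ 0) B.symm := by
      refine .single (fun t ↦ γ (1 - t)) (by simp) (by simp) ?_ fun v ↦ ?_
      · refine ContMDiffOn.comp (t := Icc 0 1) hγ ?_ fun t ht ↦ ?_
        · exact (contDiff_const.sub contDiff_id).contMDiff.contMDiffOn
        · exact ⟨by linarith [ht.2], by linarith [ht.1]⟩
      · obtain ⟨V, hV, h0, h1⟩ : ∃ V : ℝ → E, IsParallelAlong g γ V (Icc 0 1) ∧
          V 0 = B.symm v ∧ V 1 = B (B.symm v) := hB (B.symm v)
        refine ⟨fun t ↦ V (1 - t), hV.reverse, ?_, ?_⟩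
        · have h2 : (V 1 : E) = v := h1.trans (B.apply_symm_apply v)
          exact (congrArg V (sub_zero (1 : ℝ))).trans h2
        · have h2 : (V 0 : E) = B.symm v := h0
          exact (congrArg V (sub_self (1 : ℝ))).trans h2
    exact h.trans ih

variable [IsManifold I ∞ M]

theorem IsParallelTransport.metricAt_eq {p q : M} {A : TangentSpace I p ≃ₗ[ℝ] TangentSpace I q}
    (hA : IsParallelTransport g p q A) (v w : E) :
    metricAt g q (A v) (A w) = metricAt g p v w := by
  induction hA with
  | refl => rfl
  | step γ A B hA hγ hB ih =>
    obtain ⟨V, hV, hV0, hV1⟩ := hB (A v)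
    obtain ⟨W, hW, hW0, hW1⟩ := hB (A w)
    have h := metricAt_eq_of_isParallelAlong hγ.continuousOn hV hW
    rw [hV0, hV1, hW0, hW1] at h
    exact h.trans ih

end ParallelTransport

/-! ### Existence of parallel transport -/

section ConnectionForm

-- spaces of trilinear maps, nested three deep, exceed the default depth of the instance search
set_option maxSynthPendingDepth 3

variable {E : Type*} [NormedAddCommGroup E] [NormedSpace ℝ E]

/-- The Christoffel symbols of the first kind as a continuous trilinear map. -/
noncomputable def christoffelTrilinear (G : E → E →L[ℝ] E →L[ℝ] ℝ) (y : E) :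
    E →L[ℝ] E →L[ℝ] E →L[ℝ] ℝ :=
  (1 / 2 : ℝ) • (fderiv ℝ G y + (fderiv ℝ G y).flip
    - (ContinuousLinearMap.flipₗᵢ ℝ E E ℝ).toContinuousLinearEquiv.toContinuousLinearMap ∘L
      (fderiv ℝ G y).flip)

theorem christoffelTrilinear_apply (G : E → E →L[ℝ] E →L[ℝ] ℝ) (y u v w : E) :
    christoffelTrilinear G y u v w = christoffelForm G y u v w := by
  simp [christoffelTrilinear, christoffelForm]

/-- The connection form `-Γ` of the second kind: minus the Christoffel symbols of the first kind
with the last index raised by the inverse of `G y`. -/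
noncomputable def connectionForm (G : E → E →L[ℝ] E →L[ℝ] ℝ) (y : E) : E →L[ℝ] E →L[ℝ] E :=
  -(ContinuousLinearMap.compL ℝ E (E →L[ℝ] ℝ) E (G y).inverse ∘L christoffelTrilinear G y)

variable [FiniteDimensional ℝ E]

theorem isInvertible_form {B : E →L[ℝ] E →L[ℝ] ℝ} (hB : ∀ v, (∀ w, B v w = 0) → v = 0) :
    B.IsInvertible := by
  have hinj : Function.Injective B := by
    refine (injective_iff_map_eq_zero B).2 fun v hv ↦ hB v fun w ↦ ?_
    rw [hv]; rfl
  have hfin : Module.finrank ℝ E = Module.finrank ℝ (E →L[ℝ] ℝ) := by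
    rw [← (LinearMap.toContinuousLinearMap (𝕜 := ℝ) (E := E) (F' := ℝ)).finrank_eq]
    exact (Subspace.dual_finrank_eq (K := ℝ) (V := E)).symm
  refine ⟨(LinearEquiv.ofInjectiveOfFinrankEq B.toLinearMap hinj hfin).toContinuousLinearEquiv, ?_⟩
  ext; rfl

theorem apply_connectionForm {G : E → E →L[ℝ] E →L[ℝ] ℝ} {y : E}
    (hG : ∀ v, (∀ w, G y v w = 0) → v = 0) (u v w : E) :
    G y (connectionForm G y u v) w = -christoffelForm G y u v w := by
  have h : G y ((G y).inverse (christoffelTrilinear G y u v)) = christoffelTrilinear G y u v :=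
    (isInvertible_form hG).self_apply_inverse _
  simp [connectionForm, h, christoffelTrilinear_apply]

theorem continuousAt_connectionForm {G : E → E →L[ℝ] E →L[ℝ] ℝ} {y : E}
    (hG : ∀ v, (∀ w, G y v w = 0) → v = 0) (hG1 : ContDiffAt ℝ ∞ G y) :
    ContinuousAt (connectionForm G) y := by
  have h1 : ContinuousAt (fderiv ℝ G) y := (hG1.fderiv_right (m := 0) (by simp)).continuousAt
  have h2 : ContinuousAt (fun z ↦ (G z).inverse) y := by
    obtain ⟨e, he⟩ := isInvertible_form hG
    have h3 := contDiffAt_map_inverse (𝕜 := ℝ) (n := 0) e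
    rw [he] at h3
    exact ContinuousAt.comp (g := ContinuousLinearMap.inverse) h3.continuousAt hG1.continuousAt
  have h4 : ContinuousAt (fun z ↦ (fderiv ℝ G z).flip) y :=
    ContinuousAt.comp (g := ContinuousLinearMap.flip)
      (ContinuousLinearMap.flipₗᵢ ℝ E E (E →L[ℝ] ℝ)).continuous.continuousAt h1
  have h5 : ContinuousAt (christoffelTrilinear G) y :=
    ((h1.add h4).sub (continuousAt_const.clm_comp h4)).const_smul (1 / 2 : ℝ)
  have h6 : ContinuousAt (fun z ↦ ContinuousLinearMap.compL ℝ E (E →L[ℝ] ℝ) E (G z).inverse) y :=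
    (ContinuousLinearMap.compL ℝ E (E →L[ℝ] ℝ) E).continuous.continuousAt.comp h2
  exact (h6.clm_comp h5).neg

end ConnectionForm

section LocalTransport

variable {E : Type*} [NormedAddCommGroup E] [NormedSpace ℝ E]
  {H : Type*} [TopologicalSpace H] {I : ModelWithCorners ℝ E H}
  {M : Type*} [TopologicalSpace M] [ChartedSpace H M] [I.Boundaryless] [IsManifold I ∞ M]

/-- The differential of a chart as a linear isomorphism. -/
noncomputable def chartDerivEquiv (x₀ x : M) (hx : x ∈ (extChartAt I x₀).source) : E ≃ₗ[ℝ] E :=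
  { (chartDeriv I x₀ x).toLinearMap with
    invFun := chartSymmDeriv I x₀ (extChartAt I x₀ x)
    left_inv := chartSymmDeriv_chartDeriv hx
    right_inv := fun v ↦ by
      have h := chartDeriv_chartSymmDeriv ((extChartAt I x₀).map_source hx) v
      rwa [(extChartAt I x₀).left_inv hx] at h }

variable [FiniteDimensional ℝ E] (g : PseudoRiemannianMetric I M)

/-- Parallel transport from `p` to nearby points exists and depends differentiably on the end
point at `p`, with derivative given by the Christoffel symbols. -/
theorem exists_local_transport (p : M) :
    ∃ (Φ : E → E →L[ℝ] E) (D : E →L[ℝ] E →L[ℝ] E),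
      Φ (extChartAt I p p) = ContinuousLinearMap.id ℝ E ∧
      HasFDerivAt Φ D (extChartAt I p p) ∧
      (∀ u v w, coordMetric g p (extChartAt I p p) (D u v) w
        = -christoffelForm (coordMetric g p) (extChartAt I p p) u v w) ∧
      ∀ᶠ y in nhds (extChartAt I p p),
        ∃ A : TangentSpace I p ≃ₗ[ℝ] TangentSpace I ((extChartAt I p).symm y),
          IsParallelTransport g p ((extChartAt I p).symm y) A ∧
          ∀ v : E, chartDeriv I p ((extChartAt I p).symm y) (A v) = Φ y (chartDeriv I p p v) := by
  have hps := mem_extChartAt_source (I := I) p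
  set y₀ := extChartAt I p p with hy₀
  have hy₀t : y₀ ∈ (extChartAt I p).target := (extChartAt I p).map_source hps
  have htarget : ∀ᶠ y in nhds y₀, y ∈ (extChartAt I p).target := extChartAt_target_mem_nhds' hy₀t
  have hnd : ∀ y ∈ (extChartAt I p).target, ∀ v, (∀ w, coordMetric g p y v w = 0) → v = 0 :=
    fun y hy v hv ↦ coordMetric_nondegenerate g hy hv
  obtain ⟨Φ, hΦ, hΦ₀, hΦ'⟩ := exists_segment_transport (K := connectionForm (coordMetric g p))
    (y₀ := y₀) (htarget.mono fun y hy ↦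
      continuousAt_connectionForm (hnd y hy) (contDiffAt_coordMetric g hy))
  refine ⟨fun y ↦ Φ y 1, connectionForm (coordMetric g p) y₀, hΦ₀, hΦ',
    apply_connectionForm (hnd y₀ hy₀t), ?_⟩
  obtain ⟨δ, hδ, hball⟩ := Metric.eventually_nhds_iff_ball.1 htarget
  have hunit : ∀ᶠ y in nhds y₀, IsUnit (Φ y 1) := by
    have h1 : IsUnit (Φ y₀ 1) := by rw [hΦ₀]; exact isUnit_one
    exact hΦ'.continuousAt.eventually (Units.isOpen.mem_nhds h1)
  filter_upwards [hΦ, hunit, Metric.ball_mem_nhds y₀ hδ] with y hy hyu hyδ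
  obtain ⟨h0, hder⟩ := hy
  set c : ℝ → E := fun t ↦ y₀ + t • (y - y₀) with hc
  have hct : ∀ t ∈ Icc (0 : ℝ) 1, c t ∈ (extChartAt I p).target := by
    intro t ht
    refine hball _ ?_
    rw [mem_ball_iff_norm] at hyδ ⊢
    rw [hc, add_sub_cancel_left, norm_smul, Real.norm_of_nonneg ht.1]
    exact (mul_le_of_le_one_left (norm_nonneg _) ht.2).trans_lt hyδ
  have hc0 : c 0 = y₀ := by simp [hc]
  have hc1 : c 1 = y := by simp [hc]
  have hyt : y ∈ (extChartAt I p).target := hc1 ▸ hct 1 (right_mem_Icc.2 zero_le_one)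
  have hcder : ∀ t, HasDerivAt c (y - y₀) t := fun t ↦ by
    have h := ((hasDerivAt_id t).smul_const (y - y₀)).const_add y₀
    rwa [one_smul] at h
  obtain ⟨Ψ, hΨ⟩ : ∃ Ψ : E ≃L[ℝ] E, (Ψ : E →L[ℝ] E) = Φ y 1 := by
    obtain ⟨u, hu⟩ := hyu
    exact ⟨ContinuousLinearEquiv.ofUnit u, hu⟩
  have hys : (extChartAt I p).symm y ∈ (extChartAt I p).source := (extChartAt I p).map_target hyt
  have hγ : ContMDiffOn 𝓘(ℝ, ℝ) I 1 (fun t ↦ (extChartAt I p).symm (c t)) (Icc 0 1) := by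
    have hM : IsManifold I 1 M := IsManifold.of_le (n := ∞) (by simp)
    refine (contMDiffOn_extChartAt_symm p).comp (t := (extChartAt I p).target) ?_ hct
    have : ContDiff ℝ 1 c := contDiff_const.add (contDiff_id.smul contDiff_const)
    exact this.contMDiff.contMDiffOn
  refine ⟨(chartDerivEquiv p p hps).trans (Ψ.toLinearEquiv.trans
    (chartDerivEquiv p ((extChartAt I p).symm y) hys).symm), ?_, fun v ↦ ?_⟩
  · refine .single (fun t ↦ (extChartAt I p).symm (c t)) ?_ ?_ hγ fun v ↦ ?_
    · simp only [hc0, hy₀, (extChartAt I p).left_inv hps]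
    · simp only [hc1]
    refine ⟨fun t ↦ chartSymmDeriv I p (c t) (Φ y t (chartDeriv I p p v)), ?_, ?_, ?_⟩
    · refine isParallelAlong_of_chart hγ.continuousOn p
        (fun t ht ↦ (extChartAt I p).map_target (hct t ht)) fun t ht ↦ ?_
      have hright := (extChartAt I p).right_inv (hct t ht)
      refine ⟨y - y₀, connectionForm (coordMetric g p) (c t) (y - y₀)
        (Φ y t (chartDeriv I p p v)), ?_, ?_, fun w ↦ ?_⟩
      · refine (hcder t).hasDerivWithinAt.congr_of_mem (fun τ hτ ↦ ?_) ht
        exact (extChartAt I p).right_inv (hct τ hτ)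
      · have h1 := (hder t ht).clm_apply (hasDerivWithinAt_const t (Icc 0 1) (chartDeriv I p p v))
        rw [map_zero, add_zero] at h1
        refine h1.congr_of_mem (fun τ hτ ↦ ?_) ht
        exact chartDeriv_chartSymmDeriv (hct τ hτ) _
      · rw [chartDeriv_chartSymmDeriv (hct t ht), hright,
          apply_connectionForm (hnd _ (hct t ht)), neg_add_cancel]
    · show chartSymmDeriv I p (c 0) (Φ y 0 (chartDeriv I p p v)) = v
      rw [h0, hc0]
      exact chartSymmDeriv_chartDeriv hps v
    · show chartSymmDeriv I p (c 1) (Φ y 1 (chartDeriv I p p v)) = _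
      rw [hc1, ← hΨ]
      show _ = chartSymmDeriv I p (extChartAt I p ((extChartAt I p).symm y))
        (Ψ (chartDeriv I p p v))
      rw [(extChartAt I p).right_inv hyt]
      rfl
  · show chartDeriv I p ((extChartAt I p).symm y)
      (chartSymmDeriv I p (extChartAt I p ((extChartAt I p).symm y))
        (Ψ (chartDeriv I p p v))) = Φ y 1 (chartDeriv I p p v)
    rw [(extChartAt I p).right_inv hyt, chartDeriv_chartSymmDeriv hyt, ← hΨ]
    rfl

theorem eventually_exists_transport (p : M) :
    ∀ᶠ q in nhds p, ∃ A : TangentSpace I p ≃ₗ[ℝ] TangentSpace I q,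
      IsParallelTransport g p q A := by
  obtain ⟨Φ, D, -, -, -, h⟩ := exists_local_transport g p
  filter_upwards [(continuousAt_extChartAt (I := I) p).eventually h,
    extChartAt_source_mem_nhds (I := I) p] with q hq hqs
  obtain ⟨A, hA, -⟩ := hq
  have := (extChartAt I p).left_inv hqs
  rw [this] at hA
  exact ⟨_, hA⟩

/-- In a connected manifold any two tangent spaces are related by a parallel transport. -/
theorem exists_transport [ConnectedSpace M] (p q : M) :
    ∃ A : TangentSpace I p ≃ₗ[ℝ] TangentSpace I q, IsParallelTransport g p q A := by
  -- the points reachable from `p` form an open set, and so do the unreachable ones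
  have hclopen : IsClopen {q : M | ∃ A : TangentSpace I p ≃ₗ[ℝ] TangentSpace I q,
      IsParallelTransport g p q A} := by
    refine ⟨isOpen_compl_iff.1 (isOpen_iff_mem_nhds.2 fun q hq ↦ ?_),
      isOpen_iff_mem_nhds.2 fun q hq ↦ ?_⟩
    · filter_upwards [eventually_exists_transport g q] with r hr hr'
      obtain ⟨A, hA⟩ := hr
      obtain ⟨B, hB⟩ := hr'
      exact hq ⟨_, hB.trans hA.symm⟩
    · obtain ⟨A, hA⟩ := hq
      filter_upwards [eventually_exists_transport g q] with r hr
      obtain ⟨B, hB⟩ := hr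
      exact ⟨_, hA.trans hB⟩
  have h := hclopen.eq_univ ⟨p, _, .refl p⟩
  exact (Set.ext_iff.1 h q).2 (mem_univ q)

end LocalTransport

/-! ### The cone and its Euler field -/

section ConeGeometry

variable {E : Type*} [NormedAddCommGroup E] [NormedSpace ℝ E]
  {H : Type*} [TopologicalSpace H] {I : ModelWithCorners ℝ E H}
  {M : Type*} [TopologicalSpace M] [ChartedSpace H M]

/-- The point of the cone over `x` at radius one. -/
def unitPoint (x : M) : Cone M := (⟨1, mem_Ioi.2 one_pos⟩, x)

theorem extChartAt_cone_apply (p q : Cone M) :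
    extChartAt (𝓘(ℝ, ℝ).prod I) p q = ((q.1 : ℝ), extChartAt I p.2 q.2) := by
  rw [extChartAt_prod]; rfl

theorem unitPoint_symm_eq (x : M) {y : ℝ × E} (hy1 : y.1 = 1)
    (hy : y ∈ (extChartAt (𝓘(ℝ, ℝ).prod I) (unitPoint x)).target) :
    (extChartAt (𝓘(ℝ, ℝ).prod I) (unitPoint x)).symm y
      = unitPoint ((extChartAt I x).symm y.2) := by
  obtain ⟨h1, h2, -⟩ := extChartAt_cone_symm I (unitPoint x) y hy
  exact Prod.ext (Subtype.ext (h1.trans hy1)) h2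

variable [IsManifold I ∞ M]

theorem chartDeriv_self (x : M) (v : E) : chartDeriv I x x v = v := by
  have : IsManifold I 1 M := IsManifold.of_le (n := ∞) (by simp)
  have h := mfderiv_extChartAt_self (I := I) (x := x)
  exact congrArg (fun L : E →L[ℝ] E ↦ L v) h

/-- The radial coordinate vector field is constant in the charts of the cone. -/
theorem chartDeriv_cone_radial (p q : Cone M)
    (hq : q ∈ (extChartAt (𝓘(ℝ, ℝ).prod I) p).source) :
    chartDeriv (𝓘(ℝ, ℝ).prod I) p q (1, 0) = (1, 0) := by
  have hM : IsManifold I 1 M := IsManifold.of_le (n := ∞) (by simp)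
  have hd : MDifferentiableAt (𝓘(ℝ, ℝ).prod I) 𝓘(ℝ, ℝ × E)
      (extChartAt (𝓘(ℝ, ℝ).prod I) p) q :=
    mdifferentiableAt_extChartAt (by rwa [extChartAt_source] at hq)
  have hq2 : q.2 ∈ (chartAt H p.2).source := by
    rw [extChartAt_prod, PartialEquiv.prod_source] at hq
    have := hq.2
    rwa [extChartAt_source] at this
  refine Prod.ext ?_ ?_
  · have h := mfderiv_comp_apply (I'' := 𝓘(ℝ, ℝ)) q
      (differentiableAt_fst (𝕜 := ℝ) (E := ℝ) (F := E)
        (p := extChartAt (𝓘(ℝ, ℝ).prod I) p q)).mdifferentiableAt hd ((1, 0) : ℝ × E)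
    have he : (Prod.fst : ℝ × E → ℝ) ∘ extChartAt (𝓘(ℝ, ℝ).prod I) p = radius := by
      ext z
      simp only [Function.comp, extChartAt_cone_apply]
      rfl
    rw [he, mfderiv_eq_fderiv, fderiv_fst] at h
    exact h.symm.trans (dradius_apply I q ((1, 0) : ℝ × E))
  · have h := mfderiv_comp_apply (I'' := 𝓘(ℝ, E)) q
      (differentiableAt_snd (𝕜 := ℝ) (E := ℝ) (F := E)
        (p := extChartAt (𝓘(ℝ, ℝ).prod I) p q)).mdifferentiableAt hd ((1, 0) : ℝ × E)
    have he : (Prod.snd : ℝ × E → E) ∘ extChartAt (𝓘(ℝ, ℝ).prod I) p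
        = extChartAt I p.2 ∘ (Prod.snd : Cone M → M) := by
      ext z
      simp only [Function.comp, extChartAt_cone_apply]
    have h' := mfderiv_comp_apply (I := 𝓘(ℝ, ℝ).prod I) (I' := I) (I'' := 𝓘(ℝ, E)) q
      (mdifferentiableAt_extChartAt hq2)
      (mdifferentiableAt_snd (I := 𝓘(ℝ, ℝ)) (I' := I) (x := q)) ((1, 0) : ℝ × E)
    rw [he, mfderiv_eq_fderiv, fderiv_snd] at h
    refine (h.symm.trans h').trans ?_
    have h3 : (dproj I q ((1, 0) : ℝ × E) : E) = 0 := dproj_apply I q ((1, 0) : ℝ × E)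
    exact (congrArg (chartDeriv I p.2 q.2) h3).trans (map_zero _)

variable [I.Boundaryless] (g : PseudoRiemannianMetric I M)

theorem metricAt_unitPoint (x : M) (v w : ℝ × E) :
    metricAt (coneMetric I g) (unitPoint x) v w = v.1 * w.1 + metricAt g x v.2 w.2 := by
  have : IsManifold I 1 M := IsManifold.of_le (n := ∞) (by simp)
  refine (coneForm_apply I g.form (unitPoint x) v w).trans ?_
  simp only [unitPoint, one_pow, one_mul]
  rfl

variable [FiniteDimensional ℝ E]

theorem coordMetric_cone (p : Cone M) {y : ℝ × E}
    (hy : y ∈ (extChartAt (𝓘(ℝ, ℝ).prod I) p).target) (u v : ℝ × E) :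
    coordMetric (coneMetric I g) p y u v
      = u.1 * v.1 + y.1 ^ 2 * coordMetric g p.2 y.2 u.2 v.2 :=
  coordForm_coneForm I g.form p u v y hy

/-- The Levi-Civita connection of the cone satisfies `∇_w ξ = w` for the Euler field `ξ`, at the
points of radius one and for vectors `w` tangent to the base. -/
theorem christoffelForm_cone (x : M) (w : E) (z : ℝ × E) :
    christoffelForm (coordMetric (coneMetric I g) (unitPoint x))
        (extChartAt (𝓘(ℝ, ℝ).prod I) (unitPoint x) (unitPoint x)) (0, w) (1, 0) z
      = coordMetric (coneMetric I g) (unitPoint x)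
        (extChartAt (𝓘(ℝ, ℝ).prod I) (unitPoint x) (unitPoint x)) (0, w) z := by
  set p := unitPoint x with hp
  set y₀ := extChartAt (𝓘(ℝ, ℝ).prod I) p p with hy₀
  have hy₀1 : y₀.1 = 1 := by rw [hy₀, extChartAt_cone_apply]; rfl
  have hy₀t : y₀ ∈ (extChartAt (𝓘(ℝ, ℝ).prod I) p).target := mem_extChartAt_target p
  have hd := (differentiableAt_coordMetric (coneMetric I g) hy₀t).hasFDerivAt
  have hev : ∀ᶠ y in nhds y₀, y ∈ (extChartAt (𝓘(ℝ, ℝ).prod I) p).target :=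
    extChartAt_target_mem_nhds' hy₀t
  -- the derivative of a coefficient in the direction `a` is computed along the line `y₀ + s a`
  have hline : ∀ a u v : ℝ × E, HasDerivAt
      (fun s : ℝ ↦ u.1 * v.1 + (y₀ + s • a).1 ^ 2 * coordMetric g x (y₀ + s • a).2 u.2 v.2)
      (fderiv ℝ (coordMetric (coneMetric I g) p) y₀ a u v) 0 := by
    intro a u v
    have h1 := ((hd.clm_apply (hasFDerivAt_const u y₀)).clm_apply
      (hasFDerivAt_const v y₀)).hasLineDerivAt a
    have h2 : HasDerivAt (fun s : ℝ ↦ coordMetric (coneMetric I g) p (y₀ + s • a) u v)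
      (fderiv ℝ (coordMetric (coneMetric I g) p) y₀ a u v) 0 := by
      simpa [HasLineDerivAt] using h1
    refine h2.congr_of_eventuallyEq ?_
    have hc : ContinuousAt (fun s : ℝ ↦ y₀ + s • a) 0 := by fun_prop
    have hc0 : y₀ + (0 : ℝ) • a = y₀ := by simp
    rw [ContinuousAt, hc0] at hc
    filter_upwards [hc.eventually hev] with s hs
    exact (coordMetric_cone g p hs u v).symm
  have hradial : ∀ a v : ℝ × E,
      fderiv ℝ (coordMetric (coneMetric I g) p) y₀ a (1, 0) v = 0 := by
    intro a v
    have h := hline a (1, 0) v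
    simp only [map_zero, zero_apply, mul_zero, add_zero, one_mul] at h
    exact h.unique (hasDerivAt_const _ _)
  have h1 : fderiv ℝ (coordMetric (coneMetric I g) p) y₀ (1, 0) (0, w) z
      = 2 * coordMetric g x y₀.2 w z.2 := by
    have h := hline (1, 0) (0, w) z
    have h' : HasDerivAt (fun s : ℝ ↦ (0 : ℝ) * z.1 + (y₀.1 + s) ^ 2 * coordMetric g x y₀.2 w z.2)
        (2 * coordMetric g x y₀.2 w z.2) 0 := by
      have h2 := ((((hasDerivAt_id (0 : ℝ)).const_add y₀.1).pow 2).mul_const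
        (coordMetric g x y₀.2 w z.2)).const_add ((0 : ℝ) * z.1)
      refine h2.congr_deriv ?_
      simp [hy₀1]
    refine h.unique ?_
    simpa using h'
  have h2 : fderiv ℝ (coordMetric (coneMetric I g) p) y₀ z (0, w) (1, 0) = 0 := by
    rw [fderiv_coordMetric_symm (coneMetric I g) hy₀t, hradial]
  rw [coordMetric_cone g p hy₀t, christoffelForm, hradial, h1, h2, hy₀1]
  simp only [hp, unitPoint]
  ring

/-- Let `ζ y` be the Euler vector at the point of radius one over the point with coordinates `y`,
transported to the point over `x`. To first order `ζ` varies by the displacement from `x`. -/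
theorem exists_development (x : M) :
    ∃ ζ : E → ℝ × E, ζ (extChartAt I x x) = (1, 0) ∧
      HasFDerivAt ζ (ContinuousLinearMap.inr ℝ ℝ E) (extChartAt I x x) ∧
      ∀ᶠ y in nhds (extChartAt I x x),
        ∃ A : TangentSpace (𝓘(ℝ, ℝ).prod I) (unitPoint x) ≃ₗ[ℝ]
            TangentSpace (𝓘(ℝ, ℝ).prod I) (unitPoint ((extChartAt I x).symm y)),
          IsParallelTransport (coneMetric I g) (unitPoint x)
            (unitPoint ((extChartAt I x).symm y)) A ∧
          (A (ζ y) : ℝ × E) = (1, 0) := by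
  obtain ⟨Φ, D, hΦ₀, hΦ', hD, hev⟩ := exists_local_transport (coneMetric I g) (unitPoint x)
  set p := unitPoint x with hp
  set y₀ := extChartAt (𝓘(ℝ, ℝ).prod I) p p with hy₀
  have hy₀eq : y₀ = (1, extChartAt I x x) := by rw [hy₀, extChartAt_cone_apply]; rfl
  have hy₀t : y₀ ∈ (extChartAt (𝓘(ℝ, ℝ).prod I) p).target := mem_extChartAt_target p
  -- lowering the index, `D (0, w) (1, 0)` is minus the Christoffel symbol with Euler entry
  have hDw : ∀ w : E, D (0, w) (1, 0) = -(0, w) := by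
    intro w
    rw [← sub_eq_zero]
    refine coordMetric_nondegenerate (coneMetric I g) hy₀t fun z ↦ ?_
    rw [map_sub, map_neg, sub_apply, neg_apply, hD, christoffelForm_cone, sub_self]
  have hι : HasFDerivAt (fun y : E ↦ ((1 : ℝ), y)) (ContinuousLinearMap.inr ℝ ℝ E)
      (extChartAt I x x) := by
    simpa [ContinuousLinearMap.inr] using!
      hasFDerivAt_prodMk_right (𝕜 := ℝ) (1 : ℝ) (extChartAt I x x)
  rw [hy₀eq] at hΦ' hΦ₀ hev
  have hΦι : HasFDerivAt (fun y : E ↦ Φ (1, y)) (D ∘L ContinuousLinearMap.inr ℝ ℝ E)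
      (extChartAt I x x) := HasFDerivAt.comp (g := Φ) (extChartAt I x x) hΦ' hι
  have hinv : HasFDerivAt (fun y : E ↦ Ring.inverse (Φ (1, y)))
      (-(D ∘L ContinuousLinearMap.inr ℝ ℝ E)) (extChartAt I x x) := by
    have h1 := hasFDerivAt_ringInverse (𝕜 := ℝ) (1 : (ℝ × E →L[ℝ] ℝ × E)ˣ)
    have h2 : (((1 : (ℝ × E →L[ℝ] ℝ × E)ˣ) : ℝ × E →L[ℝ] ℝ × E)) = Φ (1, extChartAt I x x) := by
      rw [hΦ₀]; rfl
    rw [h2] at h1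
    refine (HasFDerivAt.comp (g := Ring.inverse) (extChartAt I x x) h1 hΦι).congr_fderiv ?_
    ext1 w
    simp
  have hunit : ∀ᶠ y in nhds (extChartAt I x x), IsUnit (Φ (1, y)) := by
    have h1 : IsUnit (Φ (1, extChartAt I x x)) := by rw [hΦ₀]; exact isUnit_one
    exact hΦι.continuousAt.eventually (Units.isOpen.mem_nhds h1)
  refine ⟨fun y ↦ Ring.inverse (Φ (1, y)) (1, 0), ?_, ?_, ?_⟩
  · have h1 : Ring.inverse (Φ (1, extChartAt I x x)) = ContinuousLinearMap.id ℝ (ℝ × E) := by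
      rw [hΦ₀]; exact Ring.inverse_one _
    simp only [h1, ContinuousLinearMap.id_apply]
  · refine (hinv.clm_apply (hasFDerivAt_const ((1, 0) : ℝ × E) _)).congr_fderiv ?_
    ext1 w
    simp [hDw]
  · have htarget : ∀ᶠ y in nhds ((1 : ℝ), extChartAt I x x),
        y ∈ (extChartAt (𝓘(ℝ, ℝ).prod I) p).target := by
      rw [← hy₀eq]; exact extChartAt_target_mem_nhds' hy₀t
    filter_upwards [hunit, hι.continuousAt.eventually (hev.and htarget)] with y hyu hy
    obtain ⟨⟨A, hA, hAΦ⟩, hyt⟩ := hy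
    have hAζ : (A (Ring.inverse (Φ (1, y)) (1, 0)) : ℝ × E) = (1, 0) := by
      have hs := (extChartAt (𝓘(ℝ, ℝ).prod I) p).map_target hyt
      refine (chartDerivEquiv p _ hs).injective ?_
      refine (hAΦ _).trans ?_
      rw [chartDeriv_self]
      refine Eq.trans ?_ (chartDeriv_cone_radial p _ hs).symm
      exact congrArg (fun L : ℝ × E →L[ℝ] ℝ × E ↦ L (1, 0)) (Ring.mul_inverse_cancel _ hyu)
    rw [unitPoint_symm_eq x rfl hyt] at hA
    exact ⟨_, hA, hAζ⟩

end ConeGeometry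

/-! ### Quadratic forms at extrema -/

section QuadraticForm

/-- Orthogonal projection onto a nondegenerate subspace. -/
theorem exists_orthogonalProjection {W : Type*} [AddCommGroup W] [Module ℝ W]
    [FiniteDimensional ℝ W] {b : LinearMap.BilinForm ℝ W} (hb : b.IsSymm) {U : Submodule ℝ W}
    (hU : ∀ u ∈ U, (∀ w ∈ U, b u w = 0) → u = 0) :
    ∃ P : W →ₗ[ℝ] W, (∀ v, P v ∈ U) ∧ (∀ v, ∀ u ∈ U, b (v - P v) u = 0) := by
  have hc : IsCompl U (b.orthogonal U) := by
    rw [LinearMap.BilinForm.isCompl_orthogonal_iff_disjoint hb.isRefl, Submodule.disjoint_def]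
    intro u hu hu'
    refine hU u hu fun w hw ↦ ?_
    have h : b w u = 0 := hu' w hw
    exact (hb.eq u w).trans h
  refine ⟨U.projection _ hc, fun v ↦ Submodule.projection_apply_mem hc v, fun v u hu ↦ ?_⟩
  have h : b u (v - U.projection _ hc v) = 0 := Submodule.sub_projection_mem hc v u hu
  exact (hb.eq _ _).trans h

variable {E F : Type*} [NormedAddCommGroup E] [NormedSpace ℝ E] [NormedAddCommGroup F]
  [NormedSpace ℝ F] [FiniteDimensional ℝ F]

/-- If a quadratic form is nonnegative on the values of a map `f` near a zero `y₀` of `f`, then it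
is nonnegative on the range of the differential of `f` at `y₀`. -/
theorem nonneg_on_fderiv (b : LinearMap.BilinForm ℝ F) {f : E → F} {f' : E →L[ℝ] F} {y₀ : E}
    (hf : HasFDerivAt f f' y₀) (h0 : f y₀ = 0) (hb : ∀ᶠ y in nhds y₀, 0 ≤ b (f y) (f y)) (w : E) :
    0 ≤ b (f' w) (f' w) := by
  have hcont : Continuous fun v : F ↦ b v v := by
    have h : Continuous fun v : F ↦ LinearMap.toContinuousLinearMap
        ((LinearMap.toContinuousLinearMap (𝕜 := ℝ) (E := F) (F' := ℝ)).toLinearMap ∘ₗ b) v v := by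
      fun_prop
    exact h
  have hl := (hf.hasLineDerivAt w)
  have ht := (hasDerivAt_iff_tendsto_slope.1 hl)
  have hev : ∀ᶠ t : ℝ in nhdsWithin 0 {0}ᶜ, 0 ≤ b (f (y₀ + t • w)) (f (y₀ + t • w)) := by
    have hc : ContinuousAt (fun t : ℝ ↦ y₀ + t • w) 0 := by fun_prop
    have hc0 : y₀ + (0 : ℝ) • w = y₀ := by simp
    rw [ContinuousAt, hc0] at hc
    exact (hc.eventually hb).filter_mono nhdsWithin_le_nhds
  refine ge_of_tendsto ((hcont.tendsto _).comp ht) (hev.mono fun t ht ↦ ?_)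
  have : slope (fun t : ℝ ↦ f (y₀ + t • w)) 0 t = t⁻¹ • f (y₀ + t • w) := by
    simp [slope_def_module, h0]
  simp only [Function.comp, this, map_smul, LinearMap.smul_apply, smul_eq_mul]
  rw [← mul_assoc]
  exact mul_nonneg (mul_self_nonneg _) ht

/-- The derivative of a quadratic form along a map vanishes at a local extremum. -/
theorem eq_zero_of_isLocalExtr (b : LinearMap.BilinForm ℝ F) (hb : b.IsSymm) {f : E → F}
    {f' : E →L[ℝ] F} {y₀ : E} (hf : HasFDerivAt f f' y₀)
    (h : IsLocalExtr (fun y ↦ b (f y) (f y)) y₀) (w : E) : b (f y₀) (f' w) = 0 := by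
  set B : F →L[ℝ] F →L[ℝ] ℝ := LinearMap.toContinuousLinearMap
    ((LinearMap.toContinuousLinearMap (𝕜 := ℝ) (E := F) (F' := ℝ)).toLinearMap ∘ₗ b) with hB
  have h1 : HasFDerivAt (fun y ↦ B (f y) (f y)) _ y₀ :=
    ((HasFDerivAt.comp (g := B) y₀ B.hasFDerivAt hf).clm_apply hf)
  have h2 := congrArg (fun L : E →L[ℝ] ℝ ↦ L w) (IsLocalExtr.hasFDerivAt_eq_zero h h1)
  have h3 : b (f y₀) (f' w) + b (f' w) (f y₀) = 0 := h2
  have h4 : b (f y₀) (f' w) = b (f' w) (f y₀) := hb.eq _ _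
  linarith

/-- Let `Z` be a map into the unit hyperboloid of `b` whose differential at `y₀` is onto the
tangent space of the hyperboloid. At a local extremum of the square of an orthogonal projection of
`Z`, the value of `Z` lies in the kernel or in the range of the projection. -/
theorem projection_eq_zero_or_self {b : LinearMap.BilinForm ℝ F} (hb : b.IsSymm)
    (hnd : ∀ v, (∀ w, b v w = 0) → v = 0) {P : F →ₗ[ℝ] F} (hPP : ∀ v, P (P v) = P v)
    (hPb : ∀ v w, b (P v) w = b v (P w)) {Z : E → F} {Z' : E →L[ℝ] F} {y₀ : E}
    (hZ : HasFDerivAt Z Z' y₀) (h1 : b (Z y₀) (Z y₀) = 1) (horth : ∀ w, b (Z y₀) (Z' w) = 0)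
    (hspan : ∀ v, ∃ (r : ℝ) (w : E), v = r • Z y₀ + Z' w)
    (hextr : IsLocalExtr (fun y ↦ b (P (Z y)) (P (Z y))) y₀) :
    P (Z y₀) = 0 ∨ P (Z y₀) = Z y₀ := by
  have hPZ : HasFDerivAt (fun y ↦ P (Z y)) (P.toContinuousLinearMap ∘L Z') y₀ :=
    HasFDerivAt.comp (g := P.toContinuousLinearMap) y₀ P.toContinuousLinearMap.hasFDerivAt hZ
  have hcrit : ∀ w, b (P (Z y₀)) (Z' w) = 0 := by
    intro w
    have h : b (P (Z y₀)) (P (Z' w)) = 0 := eq_zero_of_isLocalExtr b hb hPZ hextr w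
    rwa [← hPb, hPP] at h
  set a := b (P (Z y₀)) (Z y₀) with ha
  have hprop : P (Z y₀) = a • Z y₀ := by
    rw [← sub_eq_zero]
    refine hnd _ fun v ↦ ?_
    obtain ⟨r, w, rfl⟩ := hspan v
    simp only [map_sub, map_add, map_smul, LinearMap.sub_apply, LinearMap.smul_apply, smul_eq_mul,
      hcrit, horth, h1, ← ha]
    ring
  have hP2 : (1 - a) • P (Z y₀) = 0 := by
    have h := congrArg P hprop
    rw [hPP, map_smul] at h
    rw [sub_smul, one_smul, ← h, sub_self]
  rcases smul_eq_zero.1 hP2 with h | h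
  · right
    rw [hprop, ← sub_eq_zero.1 h, one_smul]
  · exact Or.inl h

/-- Second-order condition at a zero of `R ∘ Z`. -/
theorem nonneg_of_eventually_nonneg (b : LinearMap.BilinForm ℝ F) {R : F →ₗ[ℝ] F} {Z : E → F}
    {Z' : E →L[ℝ] F} {y₀ : E} (hZ : HasFDerivAt Z Z' y₀)
    (hspan : ∀ v, ∃ (r : ℝ) (w : E), v = r • Z y₀ + Z' w) (h0 : R (Z y₀) = 0)
    (hev : ∀ᶠ y in nhds y₀, 0 ≤ b (R (Z y)) (R (Z y))) (v : F) : 0 ≤ b (R v) (R v) := by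
  have hRZ : HasFDerivAt (fun y ↦ R (Z y)) (R.toContinuousLinearMap ∘L Z') y₀ :=
    HasFDerivAt.comp (g := R.toContinuousLinearMap) y₀ R.toContinuousLinearMap.hasFDerivAt hZ
  obtain ⟨r, w, rfl⟩ := hspan v
  rw [map_add, map_smul, h0, smul_zero, zero_add]
  exact nonneg_on_fderiv b hRZ h0 hev w

end QuadraticForm

/-! ### Holonomy-invariant subspaces of the cone -/

section Holonomy

variable {E : Type*} [NormedAddCommGroup E] [NormedSpace ℝ E] [FiniteDimensional ℝ E]
  {H : Type*} [TopologicalSpace H] {I : ModelWithCorners ℝ E H} [I.Boundaryless]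
  {M : Type*} [TopologicalSpace M] [ChartedSpace H M] [IsManifold I ∞ M]

/-- A parallel transport along a loop commutes with the orthogonal projection onto a nondegenerate
subspace that is invariant under the holonomy group. -/
theorem projection_comm_of_loop {g : PseudoRiemannianMetric I M} {p : M} {U : Submodule ℝ E}
    (hU : ∀ u ∈ U, (∀ w ∈ U, metricAt g p u w = 0) → u = 0)
    (hinv : ∀ A : TangentSpace I p ≃ₗ[ℝ] TangentSpace I p, IsParallelTransport g p p A →
      ∀ u ∈ U, (A u : E) ∈ U)
    {P : E →ₗ[ℝ] E} (hPU : ∀ v, P v ∈ U) (hP : ∀ v, ∀ u ∈ U, metricAt g p (v - P v) u = 0)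
    {A : TangentSpace I p ≃ₗ[ℝ] TangentSpace I p} (hA : IsParallelTransport g p p A) (v : E) :
    P (A v) = A (P v) := by
  refine (sub_eq_zero (G := E)).1 ?_
  refine hU _ (U.sub_mem (hPU _) (hinv A hA _ (hPU v))) fun u hu ↦ ?_
  have h1 := hP (A v : E) u hu
  have h2 : metricAt g p (A (v - P v) : E) u = 0 := by
    have h3 := hA.metricAt_eq (v - P v) (A.symm u)
    have h4 : (A (A.symm u) : E) = u := A.apply_symm_apply u
    rw [h4, hP v _ (hinv A.symm hA.symm u hu)] at h3
    exact h3
  have h3 : ∀ a c d : E, metricAt g p (a - d) u = 0 → metricAt g p (a - c) u = 0 →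
      metricAt g p (d - c) u = 0 := by
    intro a c d h h'
    rw [map_sub, LinearMap.sub_apply] at h h' ⊢
    linarith
  refine h3 (A v) (A (P v)) (P (A v)) h1 ?_
  have h4 : (A (v - P v) : E) = A v - A (P v) := A.map_sub v (P v)
  rwa [h4] at h2

end Holonomy

section MainArgument

variable {E : Type*} [NormedAddCommGroup E] [NormedSpace ℝ E] [FiniteDimensional ℝ E]
  {H : Type*} [TopologicalSpace H] {I : ModelWithCorners ℝ E H} [I.Boundaryless]
  {M : Type*} [TopologicalSpace M] [ChartedSpace H M] [IsManifold I ∞ M]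

instance connectedSpace_posReal : ConnectedSpace PosReal :=
  Subtype.connectedSpace isConnected_Ioi

variable [ConnectedSpace M] [CompactSpace M]

/-- A holonomy-invariant proper nondegenerate subspace forces the metric of the cone over a compact
connected manifold to be positive semidefinite. -/
theorem cone_nonneg_of_invariant (g : PseudoRiemannianMetric I M) {p : Cone M}
    {U : Submodule ℝ (ℝ × E)} (hbot : U ≠ ⊥) (htop : U ≠ ⊤)
    (hU : ∀ u ∈ U, (∀ w ∈ U, metricAt (coneMetric I g) p u w = 0) → u = 0)
    (hinv : ∀ A : TangentSpace (𝓘(ℝ, ℝ).prod I) p ≃ₗ[ℝ] TangentSpace (𝓘(ℝ, ℝ).prod I) p,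
      IsParallelTransport (coneMetric I g) p p A → ∀ u ∈ U, (A u : ℝ × E) ∈ U) (v : ℝ × E) :
    0 ≤ metricAt (coneMetric I g) p v v := by
  set b := metricAt (coneMetric I g) p with hbdef
  have hb : b.IsSymm := ⟨fun v w ↦ (coneMetric I g).symm p v w⟩
  have hnd : ∀ v, (∀ w, b v w = 0) → v = 0 := fun v hv ↦ (coneMetric I g).nondegenerate p v hv
  obtain ⟨P, hPU, hP⟩ := exists_orthogonalProjection hb hU
  have hPid : ∀ u ∈ U, P u = u := fun u hu ↦
    (sub_eq_zero.1 (hU _ (U.sub_mem hu (hPU u)) fun w hw ↦ hP u w hw)).symm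
  have hPP : ∀ v, P (P v) = P v := fun v ↦ hPid _ (hPU v)
  have hPb1 : ∀ v w, b v (P w) = b (P v) (P w) := by
    intro v w
    have h := hP v (P w) (hPU w)
    rw [map_sub, LinearMap.sub_apply] at h
    linarith
  have hPb : ∀ v w, b (P v) w = b v (P w) := by
    intro v w
    rw [hPb1 v w]
    exact (hb.eq w (P v)).symm.trans ((hPb1 w v).trans (hb.eq (P w) (P v)))
  set Q : (ℝ × E) →ₗ[ℝ] (ℝ × E) := LinearMap.id - P
  have hQv : ∀ v, Q v = v - P v := fun v ↦ rfl
  -- Pythagoras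
  have hPQ : ∀ v, b v v = b (P v) (P v) + b (Q v) (Q v) := by
    intro v
    have h1 := hPb1 v v
    have h2 := hPb v v
    simp only [hQv, map_sub, LinearMap.sub_apply]
    linarith
  -- `z x` is the Euler vector at radius one over `x`, transported to `p`
  choose T hT using fun x : M ↦ exists_transport (coneMetric I g) p (unitPoint x)
  set z : M → ℝ × E := fun x ↦ (T x).symm ((1, 0) : ℝ × E)
  set α : M → ℝ := fun x ↦ b (P (z x)) (P (z x)) with hα
  -- the square of the projected Euler vector does not depend on the path of transport
  have hindep : ∀ (x : M) (A : TangentSpace (𝓘(ℝ, ℝ).prod I) p ≃ₗ[ℝ]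
      TangentSpace (𝓘(ℝ, ℝ).prod I) (unitPoint x)),
      IsParallelTransport (coneMetric I g) p (unitPoint x) A →
      ∀ v : ℝ × E, (A v : ℝ × E) = (1, 0) → b (P v) (P v) = α x := by
    intro x A hA v hv
    have hloop := hA.trans (hT x).symm
    have h1 : ((A.trans (T x).symm) v : ℝ × E) = z x :=
      congrArg (fun u : ℝ × E ↦ ((T x).symm u : ℝ × E)) hv
    have h2 := projection_comm_of_loop hU hinv hPU hP hloop v
    rw [h1] at h2
    rw [hα]
    simp only [h2]
    exact (hloop.metricAt_eq (P v) (P v)).symm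
  -- local description of the transported Euler vector
  have hlocal : ∀ x : M, ∃ (Z : E → ℝ × E) (Z' : E →L[ℝ] ℝ × E), Z (extChartAt I x x) = z x ∧
      HasFDerivAt Z Z' (extChartAt I x x) ∧ b (z x) (z x) = 1 ∧ (∀ w, b (z x) (Z' w) = 0) ∧
      (∀ v, ∃ (r : ℝ) (w : E), v = r • Z (extChartAt I x x) + Z' w) ∧
      ∀ᶠ y in nhds (extChartAt I x x),
        α ((extChartAt I x).symm y) = b (P (Z y)) (P (Z y)) ∧ b (Z y) (Z y) = 1 := by
    intro x
    obtain ⟨ζ, hζ₀, hζ', hev⟩ := exists_development g x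
    set L : (ℝ × E) →ₗ[ℝ] (ℝ × E) := (T x).symm.toLinearMap
    have hLb : ∀ v w, b (L v) (L w) = metricAt (coneMetric I g) (unitPoint x) v w :=
      fun v w ↦ (hT x).symm.metricAt_eq v w
    have hLz : L (1, 0) = z x := rfl
    refine ⟨fun y ↦ L (ζ y), L.toContinuousLinearMap ∘L ContinuousLinearMap.inr ℝ ℝ E, ?_, ?_, ?_,
      fun w ↦ ?_, fun v ↦ ?_, ?_⟩
    · simp only [hζ₀, hLz]
    · exact HasFDerivAt.comp (g := L.toContinuousLinearMap) _ L.toContinuousLinearMap.hasFDerivAt hζ'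
    · rw [← hLz, hLb, metricAt_unitPoint]
      simp
    · have h := hLb (1, 0) (0, w)
      rw [metricAt_unitPoint, hLz] at h
      refine h.trans ?_
      simp
    · obtain ⟨v', rfl⟩ : ∃ v', L v' = v := ⟨T x v, (T x).symm_apply_apply v⟩
      refine ⟨v'.1, v'.2, ?_⟩
      have h : v' = v'.1 • (1, 0) + (0, v'.2) := by ext <;> simp
      conv_lhs => rw [h, map_add, map_smul, ← hζ₀]
      rfl
    · filter_upwards [hev] with y hy
      obtain ⟨A, hA, hAζ⟩ := hy
      have hTA := (hT x).trans hA
      have h1 : ((((T x).trans A) (L (ζ y) : ℝ × E)) : ℝ × E) = (1, 0) := by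
        refine Eq.trans ?_ hAζ
        exact congrArg (fun u : ℝ × E ↦ (A u : ℝ × E)) ((T x).apply_symm_apply (ζ y))
      refine ⟨(hindep _ _ hTA _ h1).symm, ?_⟩
      have h2 := hTA.metricAt_eq (L (ζ y)) (L (ζ y))
      rw [h1, metricAt_unitPoint] at h2
      rw [hbdef, ← h2]
      simp
  choose Z Z' hZ₀ hZ' hzz horth hspan hev using hlocal
  have hαcont : Continuous α := by
    refine continuous_iff_continuousAt.2 fun x ↦ ?_
    have h1 : ContinuousAt (fun y ↦ b (P (Z x y)) (P (Z x y))) (extChartAt I x x) := by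
      have h := (hZ' x).continuousAt
      have hq : Continuous fun v : ℝ × E ↦ b (P v) (P v) := by
        have hc : Continuous fun v : ℝ × E ↦ LinearMap.toContinuousLinearMap
            ((LinearMap.toContinuousLinearMap (𝕜 := ℝ) (E := ℝ × E) (F' := ℝ)).toLinearMap ∘ₗ b)
            (P.toContinuousLinearMap v) (P.toContinuousLinearMap v) := by fun_prop
        exact hc
      exact ContinuousAt.comp (g := fun v : ℝ × E ↦ b (P v) (P v)) hq.continuousAt h
    have h2 : ContinuousAt (fun q ↦ b (P (Z x (extChartAt I x q))) (P (Z x (extChartAt I x q)))) x :=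
      ContinuousAt.comp (g := fun y ↦ b (P (Z x y)) (P (Z x y))) h1 (continuousAt_extChartAt x)
    refine h2.congr ?_
    filter_upwards [(continuousAt_extChartAt (I := I) x).eventually (hev x),
      extChartAt_source_mem_nhds (I := I) x] with q hq hqs
    rw [← hq.1, (extChartAt I x).left_inv hqs]
  -- at an extremum the Euler vector lies in `U` or in its orthogonal complement
  have halt : ∀ x : M, IsLocalExtr (fun y ↦ b (P (Z x y)) (P (Z x y))) (extChartAt I x x) →
      (α x = 0 ∧ P (z x) = 0) ∨ (α x = 1 ∧ Q (z x) = 0) := by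
    intro x hx
    have h := projection_eq_zero_or_self hb hnd hPP hPb (hZ' x) (by rw [hZ₀, hzz])
      (by rw [hZ₀]; exact horth x) (hspan x) hx
    rw [hZ₀] at h
    refine h.imp (fun h ↦ ⟨?_, h⟩) (fun h ↦ ⟨?_, ?_⟩)
    · simp only [hα, h, map_zero]
    · simp only [hα, h, hzz]
    · rw [hQv, h, sub_self]
  have hαZ : ∀ x, b (P (Z x (extChartAt I x x))) (P (Z x (extChartAt I x x))) = α x := by
    intro x; rw [hZ₀]
  obtain ⟨x₀, -, hmin⟩ := isCompact_univ.exists_isMinOn univ_nonempty hαcont.continuousOn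
  obtain ⟨x₁, -, hmax⟩ := isCompact_univ.exists_isMaxOn univ_nonempty hαcont.continuousOn
  have hmin' : ∀ x, α x₀ ≤ α x := fun x ↦ hmin (mem_univ x)
  have hmax' : ∀ x, α x ≤ α x₁ := fun x ↦ hmax (mem_univ x)
  have hlmin : IsLocalMin (fun y ↦ b (P (Z x₀ y)) (P (Z x₀ y))) (extChartAt I x₀ x₀) := by
    filter_upwards [hev x₀] with y hy
    rw [hαZ, ← hy.1]
    exact hmin' _
  have hlmax : IsLocalMax (fun y ↦ b (P (Z x₁ y)) (P (Z x₁ y))) (extChartAt I x₁ x₁) := by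
    filter_upwards [hev x₁] with y hy
    rw [hαZ, ← hy.1]
    exact hmax' _
  have hQev : ∀ x, ∀ᶠ y in nhds (extChartAt I x x),
      b (Q (Z x y)) (Q (Z x y)) = 1 - b (P (Z x y)) (P (Z x y)) := by
    intro x
    filter_upwards [hev x] with y hy
    have h := hPQ (Z x y)
    rw [hy.2] at h
    linarith
  have hQproj : ∀ v w, b (Q v) w = b (Q v) (Q w) := by
    intro v w
    have h := hP v (P w) (hPU w)
    simp only [hQv, map_sub] at h ⊢
    linarith
  -- a quadratic form `b(R v, R v)` that vanishes forces `R = 0`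
  have hzero : ∀ R : (ℝ × E) →ₗ[ℝ] (ℝ × E), (∀ v w, b (R v) w = b (R v) (R w)) →
      (∀ v, b (R v) (R v) = 0) → ∀ v, R v = 0 := by
    intro R hR h0 v
    refine hnd _ fun w ↦ ?_
    have h1 := h0 (v + w)
    have h2 : b (R w) (R v) = b (R v) (R w) := hb.eq _ _
    simp only [map_add, LinearMap.add_apply] at h1
    rw [hR]
    linarith [h0 v, h0 w]
  -- the extreme values of `α` are `0` or `1`; when they agree, `P` or `Q` vanishes
  rcases halt x₀ (Or.inl hlmin) with ⟨hα₀, hP₀⟩ | ⟨hα₀, hQ₀⟩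
  · have hPnonneg : ∀ v, 0 ≤ b (P v) (P v) := by
      refine nonneg_of_eventually_nonneg b (hZ' x₀) (hspan x₀) (by rw [hZ₀, hP₀]) ?_
      filter_upwards [hlmin] with y hy
      rwa [hαZ, hα₀] at hy
    rcases halt x₁ (Or.inr hlmax) with ⟨hα₁, hP₁⟩ | ⟨hα₁, hQ₁⟩
    · have hPnonpos : ∀ v, 0 ≤ (-b) (P v) (P v) := by
        refine nonneg_of_eventually_nonneg (-b) (hZ' x₁) (hspan x₁) (by rw [hZ₀, hP₁]) ?_
        filter_upwards [hlmax] with y hy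
        rw [hαZ, hα₁] at hy
        exact neg_nonneg.2 hy
      have hP0 := hzero P (fun v w ↦ by rw [← hPb1, hPb]) fun v ↦
        le_antisymm (neg_nonneg.1 (hPnonpos v)) (hPnonneg v)
      exact absurd ((Submodule.eq_bot_iff U).2 fun u hu ↦ by rw [← hPid u hu, hP0]) hbot
    · have hQnonneg : ∀ v, 0 ≤ b (Q v) (Q v) := by
        refine nonneg_of_eventually_nonneg b (hZ' x₁) (hspan x₁) (by rw [hZ₀, hQ₁]) ?_
        filter_upwards [hlmax, hQev x₁] with y hy hy'
        rw [hαZ, hα₁] at hy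
        rw [hy']
        linarith
      rw [hPQ v]
      exact add_nonneg (hPnonneg v) (hQnonneg v)
  · have hQnonpos : ∀ v, 0 ≤ (-b) (Q v) (Q v) := by
      refine nonneg_of_eventually_nonneg (-b) (hZ' x₀) (hspan x₀) (by rw [hZ₀, hQ₀]) ?_
      filter_upwards [hlmin, hQev x₀] with y hy hy'
      rw [hαZ, hα₀] at hy
      refine neg_nonneg.2 ?_
      rw [hy']
      linarith
    rcases halt x₁ (Or.inr hlmax) with ⟨hα₁, -⟩ | ⟨hα₁, hQ₁⟩
    · have := hmin' x₁
      rw [hα₀, hα₁] at this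
      exact absurd this (by norm_num)
    · have hQnonneg : ∀ v, 0 ≤ b (Q v) (Q v) := by
        refine nonneg_of_eventually_nonneg b (hZ' x₁) (hspan x₁) (by rw [hZ₀, hQ₁]) ?_
        filter_upwards [hlmax, hQev x₁] with y hy hy'
        rw [hαZ, hα₁] at hy
        rw [hy']
        linarith
      have hQ0 := hzero Q hQproj fun v ↦
        le_antisymm (neg_nonneg.1 (hQnonpos v)) (hQnonneg v)
      refine absurd ((Submodule.eq_top_iff').2 fun v ↦ ?_) htop
      have h := hQ0 v
      rw [hQv, sub_eq_zero] at h
      rw [h]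
      exact hPU v

/-- If the cone over a compact connected manifold is decomposable, then the metric of the manifold
is Riemannian. -/
theorem pos_of_isDecomposable_cone (g : PseudoRiemannianMetric I M)
    (h : IsDecomposable (coneMetric I g)) (x : M) (v : TangentSpace I x) (hv : v ≠ 0) :
    0 < g.form x v v := by
  obtain ⟨p, U, hbot, htop, hU, hinv⟩ := h
  have hp := cone_nonneg_of_invariant g (U := U) hbot htop hU
    (fun A hA u hu ↦ hinv A (Subgroup.subset_closure hA) u hu)
  have hnonneg : ∀ w : E, 0 ≤ metricAt g x w w := by
    intro w
    obtain ⟨A, hA⟩ := exists_transport (coneMetric I g) (unitPoint x) p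
    have h1 := hp (A ((0, w) : ℝ × E))
    have h2 := hA.metricAt_eq (0, w) (0, w)
    rw [metricAt_unitPoint] at h2
    rw [h2] at h1
    simpa using h1
  refine lt_of_le_of_ne (hnonneg v) fun h0 ↦ hv (g.nondegenerate x v fun w ↦ ?_)
  have hsymm : (metricAt g x).IsSymm := ⟨fun v w ↦ g.symm x v w⟩
  have h1 := (metricAt g x).apply_sq_le_of_symm hnonneg ⟨hsymm.eq⟩ v w
  have h2 : metricAt g x v v = 0 := h0.symm
  rw [h2, zero_mul] at h1
  exact pow_eq_zero_iff (two_ne_zero) |>.1 (le_antisymm h1 (sq_nonneg _))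

end MainArgument

end PseudoRiem

theorem corollary1 (n : ℕ) {M : Type*} [TopologicalSpace M]
    [ChartedSpace (EuclideanSpace ℝ (Fin n)) M] [IsManifold (𝓡 n) ∞ M]
    [T2Space M] [CompactSpace M] [ConnectedSpace M]
    (g : PseudoRiem.PseudoRiemannianMetric (𝓡 n) M)
    (hind : PseudoRiem.IsIndefinite g) (hcomplete : PseudoRiem.IsLightLineComplete g) :
    ¬ PseudoRiem.IsDecomposable (PseudoRiem.coneMetric (𝓡 n) g) := by
  refine fun h ↦ hind ⟨1, fun x v hv ↦ ?_⟩
  rw [one_mul]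
  exact PseudoRiem.pos_of_isDecomposable_cone g h x v hv
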